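/- There is a universal constant $C>0$ and, for every dimension $d\ge 1$ and all parameters $\varepsilon,\eta>0$, a randomized adaptive tomography algorithm with the following properties. Its only quantum memory is a single $d$-dimensional register, initialized in a fixed basis state (in particular, only $n$ qubits when $d=2^n$); its steps are to apply to this register a unitary of its own choice, to apply to this register the unknown unitary $Z\in U(d)$, or to measure the register in the computational basis, and every choice may depend on the earlier measurement outcomes and on classical randomness drawn independently of $Z$. In every run it applies $Z$ at most $$C\cdot\frac{d^2}{\varepsilon^2}\cdot\log\max\{2,1/\eta\}$$ times (thus $O(d^2/\varepsilon^2)\cdot\log(1/\eta)$ times when $\eta\le\frac12$). For every $Z\in U(d)$ it outputs a classical description of a random unitary $\boldsymbol V\in U(d)$ satisfying $$\Pr\Bigl[\,\min_{\phi\in\mathbb C,\ |\phi|=1}\ \|\phi Z-\boldsymbol V\|_{\mathrm{op}}>\varepsilon\Bigr]\le\eta,$$ where $\|\cdot\|_{\mathrm{op}}$ is the largest singular value. -/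

import Mathlib

open MeasureTheory

noncomputable section

namespace UnitaryTomography

/-- The group `U(d)` of `d × d` unitary matrices. -/
abbrev UU (d : ℕ) : Type := Matrix.unitaryGroup (Fin d) ℂ

/-- `U(d)` carries its Borel σ-algebra. -/
instance instMeasurableSpaceUU (d : ℕ) : MeasurableSpace (UU d) := borel (UU d)

instance instBorelSpaceUU (d : ℕ) : BorelSpace (UU d) := ⟨rfl⟩

/-- The operator (spectral) norm of a matrix: the norm of the operator it induces on `ℂ^d` with its
Euclidean norm. -/
def opNorm {d : ℕ} (A : Matrix (Fin d) (Fin d) ℂ) : ℝ :=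
  ‖Matrix.toEuclideanCLM (𝕜 := ℂ) A‖

/-- Operator-norm distance up to a global phase. The infimum over the unit circle is a minimum,
since the circle is compact. -/
def phaseDist {d : ℕ} (U V : UU d) : ℝ :=
  ⨅ φ : Circle, opNorm ((φ : ℂ) • (U : Matrix (Fin d) (Fin d) ℂ) - (V : Matrix (Fin d) (Fin d) ℂ))

/-- An adaptive algorithm (with its classical random seed already fixed) whose only quantum memory
is a single `d`-dimensional register, and whose only access to the unknown unitary is to apply it
to that register. It is a finite tree; at each node the algorithm
* halts and outputs (the classical description of) a unitary, or
* applies a unitary of its own choice to the register, or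
* applies the unknown unitary to the register, or
* measures the register in the computational basis and continues depending on the outcome.
A measurement in another basis is a unitary followed by `measure`; the register is reset to a fixed
state by `measure` followed by a unitary that depends on the outcome. -/
inductive Protocol (d : ℕ) : Type
  | output (V : UU d) : Protocol d
  | applyUnitary (U : UU d) (next : Protocol d) : Protocol d
  | query (next : Protocol d) : Protocol d
  | measure (next : Fin d → Protocol d) : Protocol d

namespace Protocol

variable {d : ℕ}

/-- The largest number of applications of the unknown unitary over all sequences of measurement
outcomes. -/
def queries : Protocol d → ℕ
  | output _ => 0
  | applyUnitary _ next => next.queries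
  | query next => next.queries + 1
  | measure next => Finset.univ.sup fun i => (next i).queries

/-- The law of the output when the unknown unitary is `Z` and the register is in the pure state `ψ`.
By the Born rule, a measurement has outcome `i` with probability `|ψ i|²`, and leaves the register
in the basis state `i` (up to an unobservable global phase). -/
def law (Z : UU d) : Protocol d → (Fin d → ℂ) → Measure (UU d)
  | output V, _ => Measure.dirac V
  | applyUnitary U next, ψ => law Z next ((U : Matrix (Fin d) (Fin d) ℂ).mulVec ψ)
  | query next, ψ => law Z next ((Z : Matrix (Fin d) (Fin d) ℂ).mulVec ψ)
  | measure next, ψ => ∑ i, ENNReal.ofReal (‖ψ i‖ ^ 2) • law Z (next i) (Pi.single i 1)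

end Protocol

/-- A tomography algorithm on a single `d`-dimensional register: it draws a classical random seed,
independently of the unknown unitary, and then runs the protocol selected by the seed, starting
with the register in the basis state `0`. Measurability of the output law in the seed says that the
output is a random variable. -/
structure TomographyAlgorithm (d : ℕ) [NeZero d] where
  Seed : Type
  [measurableSpace : MeasurableSpace Seed]
  seedLaw : Measure Seed
  [isProbabilityMeasure : IsProbabilityMeasure seedLaw]
  protocol : Seed → Protocol d
  measurable_law : ∀ Z : UU d, Measurable fun s => (protocol s).law Z (Pi.single 0 1)

namespace TomographyAlgorithm

variable {d : ℕ} [NeZero d]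

/-- The law of the output of the algorithm when the unknown unitary is `Z`. -/
def outputLaw (A : TomographyAlgorithm d) (Z : UU d) : Measure (UU d) :=
  letI := A.measurableSpace
  A.seedLaw.bind fun s => (A.protocol s).law Z (Pi.single 0 1)

/-- In every run the algorithm applies the unknown unitary at most `Q` times. -/
def QueriesAtMost (A : TomographyAlgorithm d) (Q : ℝ) : Prop :=
  ∀ s : A.Seed, ((A.protocol s).queries : ℝ) ≤ Q

end TomographyAlgorithm

end UnitaryTomography

end

/-! A trial on a state `v` flips a coin and measures either in the computational basis or in the
Fourier basis multiplied entrywise by random fourth roots of unity. The flat outcomes `f` form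
almost a 2-design: the mean of `|f⟩⟨f| - 1` is `|v⟩⟨v|` minus its diagonal, and the computational
half supplies exactly that diagonal. So `sampleOp` is an unbiased estimator of `|v⟩⟨v|`
(`sum_trialProb_mul_inner`). Random phase sums have Gaussian-like square-exponential moments
(`sum_exp_phaseSum_sq_le`), so each matrix element `⟨x, sampleOp y⟩` has an exponential moment
bounded independently of `d` (`sum_trialProb_mul_exp_le`). Hence centred sums of trials are
sub-Gaussian near zero, and a net argument (`sum_opNorm_gt_le`) controls operator norms at the price
of a factor `625 ^ d`.

To learn `Z` with a consistent phase, write `z j` for its columns. About `d² L / ε²` trials on `z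
0`, with `L = log max {2, 1/η}`, give a unit vector `r ≈ c • z 0` with error of order `ε / √d`. For
`j ≠ 0`, about `d L / ε²` trials on `(z 0 + z j) / √2` give an operator `M j`, and `2 M j r - r ≈ c
• z j`: the unknown phase `c` comes from `r` alone and is therefore common to all columns
(`norm_column_sub_le`).

The error has two parts (`phaseDist_decode_le`). The bias from `r` may be aligned across columns, so
it is bounded with a loss of `√d`; this is why `r` is learned more accurately, at a cost comparable
to that of all columns together. The noise is independent across columns, so for unit `y` its matrix
elements are sums weighted by the `y j`, with total squared weight one, and no `√d` is lost
(`sum_estimateNoise_tail_le`). The output is any unitary close to the resulting operator. -/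

noncomputable section

namespace UnitaryTomography

/-! ### Moments of sums with random fourth-root phases -/

/-- The sum `∑ i, conj (I ^ w i) * x i`: the inner product of `x` with the vector of fourth roots of
unity encoded by `w`. -/
def phaseSum {d : ℕ} (w : Fin d → Fin 4) (x : Fin d → ℂ) : ℂ :=
  ∑ i, star (Complex.I ^ (w i : ℕ)) * x i

lemma phaseSum_cons {d : ℕ} (k : Fin 4) (w : Fin d → Fin 4) (x : Fin (d + 1) → ℂ) :
    phaseSum (Fin.cons k w) x =
      star (Complex.I ^ (k : ℕ)) * x 0 + phaseSum w (Fin.tail x) := by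
  simp [phaseSum, Fin.sum_univ_succ, Fin.tail]

lemma sum_phases_succ {M : Type*} [AddCommMonoid M] {d : ℕ} (f : (Fin (d + 1) → Fin 4) → M) :
    ∑ w, f w = ∑ w : Fin d → Fin 4, ∑ k : Fin 4, f (Fin.cons k w) := by
  rw [← (Fin.consEquiv fun _ : Fin (d + 1) => Fin 4).sum_comp, Fintype.sum_prod_type,
    Finset.sum_comm]
  rfl

lemma sum_phaseSum_mul_star {d : ℕ} (x y : Fin d → ℂ) :
    ∑ w : Fin d → Fin 4, phaseSum w x * star (phaseSum w y) = 4 ^ d * ∑ i, x i * star (y i) := by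
  induction d with
  | zero => simp [phaseSum]
  | succ d ih =>
    have key : ∀ (w : Fin d → Fin 4),
        ∑ k : Fin 4, phaseSum (Fin.cons k w) x * star (phaseSum (Fin.cons k w) y) =
          4 * (x 0 * star (y 0)) +
            4 * (phaseSum w (Fin.tail x) * star (phaseSum w (Fin.tail y))) := by
      intro w
      simp only [phaseSum_cons, Fin.sum_univ_four]
      generalize phaseSum w (Fin.tail x) = p
      generalize phaseSum w (Fin.tail y) = q
      simp [pow_succ]
      ring_nf
      simp
      ring
    rw [sum_phases_succ, Finset.sum_congr rfl fun w _ => key w, Finset.sum_add_distrib,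
      ← Finset.mul_sum _ _ (4 : ℂ), ← Finset.mul_sum _ _ (4 : ℂ), ih]
    simp [Fin.sum_univ_succ, Fin.tail]
    ring

/-- Only the two pairings of conjugated with unconjugated factors survive averaging. The subtracted
sum corrects for coinciding indices, which both pairings count. Random signs would leave a third
pairing; fourth roots of unity kill it because their squares also average to zero. -/
lemma sum_phaseSum_fourth {d : ℕ} (a b c e : Fin d → ℂ) :
    ∑ w : Fin d → Fin 4,
        phaseSum w a * star (phaseSum w b) * (phaseSum w c * star (phaseSum w e)) =
      4 ^ d * ((∑ i, a i * star (b i)) * (∑ i, c i * star (e i)) +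
        (∑ i, a i * star (e i)) * (∑ i, c i * star (b i)) -
        ∑ i, a i * star (b i) * (c i * star (e i))) := by
  induction d with
  | zero => simp [phaseSum]
  | succ d ih =>
    have key : ∀ (w : Fin d → Fin 4),
        ∑ k : Fin 4, phaseSum (Fin.cons k w) a * star (phaseSum (Fin.cons k w) b) *
          (phaseSum (Fin.cons k w) c * star (phaseSum (Fin.cons k w) e)) =
          4 * (a 0 * star (b 0) * (c 0 * star (e 0))) +
          4 * (a 0 * star (b 0)) *
            (phaseSum w (Fin.tail c) * star (phaseSum w (Fin.tail e))) +
          4 * (c 0 * star (e 0)) *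
            (phaseSum w (Fin.tail a) * star (phaseSum w (Fin.tail b))) +
          4 * (a 0 * star (e 0)) *
            (phaseSum w (Fin.tail c) * star (phaseSum w (Fin.tail b))) +
          4 * (c 0 * star (b 0)) *
            (phaseSum w (Fin.tail a) * star (phaseSum w (Fin.tail e))) +
          4 * (phaseSum w (Fin.tail a) * star (phaseSum w (Fin.tail b)) *
            (phaseSum w (Fin.tail c) * star (phaseSum w (Fin.tail e)))) := by
      intro w
      simp only [phaseSum_cons, Fin.sum_univ_four]
      generalize phaseSum w (Fin.tail a) = p
      generalize phaseSum w (Fin.tail b) = q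
      generalize phaseSum w (Fin.tail c) = r
      generalize phaseSum w (Fin.tail e) = s
      simp [pow_succ]
      ring_nf
      simp
      ring
    rw [sum_phases_succ, Finset.sum_congr rfl fun w _ => key w]
    simp only [Finset.sum_add_distrib, ← Finset.mul_sum, ih, sum_phaseSum_mul_star]
    simp [Fin.sum_univ_succ, Fin.tail]
    ring

/-- The phases `±1` and `±I` group into one `cosh` of the real part and one of the imaginary part.
-/
lemma sum_exp_re_phase_le (z : ℂ) :
    ∑ k : Fin 4, Real.exp (star (Complex.I ^ (k : ℕ)) * z).re ≤ 4 * Real.exp (‖z‖ ^ 2 / 2) := by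
  have h1 := Real.cosh_le_exp_half_sq z.re
  have h2 := Real.cosh_le_exp_half_sq z.im
  have hn : ‖z‖ ^ 2 = z.re ^ 2 + z.im ^ 2 := by
    rw [Complex.sq_norm, Complex.normSq_apply]; ring
  have h3 : Real.exp (z.re ^ 2 / 2) ≤ Real.exp (‖z‖ ^ 2 / 2) :=
    Real.exp_le_exp.2 (by nlinarith [sq_nonneg z.im])
  have h4 : Real.exp (z.im ^ 2 / 2) ≤ Real.exp (‖z‖ ^ 2 / 2) :=
    Real.exp_le_exp.2 (by nlinarith [sq_nonneg z.re])
  have e : ∑ k : Fin 4, Real.exp (star (Complex.I ^ (k : ℕ)) * z).re =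
      2 * Real.cosh z.re + 2 * Real.cosh z.im := by
    rw [Real.cosh_eq, Real.cosh_eq]
    simp [Fin.sum_univ_four, pow_succ]
    ring
  linarith

/-- The random phase sum has a square-exponential moment, as a complex Gaussian would. -/
lemma sum_exp_phaseSum_sq_le {d : ℕ} (x : Fin d → ℂ) (c : ℝ) (hc : 0 ≤ c)
    (h : 2 * c * ∑ i, ‖x i‖ ^ 2 < 1) :
    ∑ w : Fin d → Fin 4, Real.exp (c * ‖phaseSum w x‖ ^ 2) ≤
      4 ^ d / (1 - 2 * c * ∑ i, ‖x i‖ ^ 2) := by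
  induction d generalizing c with
  | zero => simp [phaseSum]
  | succ d ih =>
    set S : ℝ := ∑ i, ‖Fin.tail x i‖ ^ 2 with hS
    have hS0 : 0 ≤ S := by positivity
    have hsum : ∑ i, ‖x i‖ ^ 2 = ‖x 0‖ ^ 2 + S := by simp [Fin.sum_univ_succ, hS, Fin.tail]
    rw [hsum] at h ⊢
    set q : ℝ := ‖x 0‖ ^ 2 with hq
    have hq0 : 0 ≤ q := by positivity
    -- Averaging the cross term over the first phase costs `exp (2 c² q ‖p‖²)`, which turns the
    -- exponent `c` into `c (1 + 2 c q)`. This is why the induction generalizes `c`.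
    have key : ∀ w : Fin d → Fin 4,
        ∑ k : Fin 4, Real.exp (c * ‖phaseSum (Fin.cons k w) x‖ ^ 2) ≤
          4 * Real.exp (c * q) *
            Real.exp (c * (1 + 2 * c * q) * ‖phaseSum w (Fin.tail x)‖ ^ 2) := by
      intro w
      set p := phaseSum w (Fin.tail x) with hp
      have e : ∀ k : Fin 4, Real.exp (c * ‖phaseSum (Fin.cons k w) x‖ ^ 2) =
          Real.exp (c * q + c * ‖p‖ ^ 2) *
            Real.exp (star (Complex.I ^ (k : ℕ)) * (2 * c * x 0 * star p)).re := by
        intro k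
        rw [← Real.exp_add, phaseSum_cons, ← hp]
        congr 1
        have h1 : ‖star (Complex.I ^ (k : ℕ)) * x 0 + p‖ ^ 2 =
            q + ‖p‖ ^ 2 + 2 * (star (Complex.I ^ (k : ℕ)) * x 0 * star p).re := by
          rw [Complex.sq_norm, Complex.normSq_add, ← Complex.sq_norm, ← Complex.sq_norm]
          simp [hq]
        rw [h1, show star (Complex.I ^ (k : ℕ)) * (2 * c * x 0 * star p) =
          ((2 * c : ℝ) : ℂ) * (star (Complex.I ^ (k : ℕ)) * x 0 * star p) by push_cast; ring,
          Complex.re_ofReal_mul]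
        ring
      rw [Finset.sum_congr rfl fun k _ => e k, ← Finset.mul_sum]
      refine (mul_le_mul_of_nonneg_left (sum_exp_re_phase_le _) (Real.exp_pos _).le).trans ?_
      have h2 : ‖(2 * c * x 0 * star p : ℂ)‖ ^ 2 = 4 * c ^ 2 * q * ‖p‖ ^ 2 := by
        simp only [norm_mul, mul_pow, hq, Complex.norm_real, norm_star, Real.norm_eq_abs, sq_abs,
          Complex.norm_ofNat]
        ring
      rw [h2, mul_left_comm, ← Real.exp_add, mul_assoc 4 (Real.exp _), ← Real.exp_add]
      apply le_of_eq
      congr 2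
      ring
    rw [sum_phases_succ]
    refine (Finset.sum_le_sum fun w _ => key w).trans ?_
    rw [← Finset.mul_sum]
    have hB1 : 2 * c * S < 1 := by nlinarith [mul_nonneg hc hq0]
    have hA0 : 0 ≤ c * q := by positivity
    have hB0 : 0 ≤ 2 * c * S := by positivity
    have hA1 : c * q < 1 / 2 := by nlinarith
    have hc' : 2 * (c * (1 + 2 * c * q)) * S < 1 := by nlinarith
    refine (mul_le_mul_of_nonneg_left (ih (Fin.tail x) _ (by positivity) hc')
      (by positivity)).trans ?_
    rw [← hS]
    have hexp : Real.exp (c * q) ≤ 1 / (1 - c * q) := by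
      rw [le_div_iff₀ (by linarith)]
      have := Real.one_sub_le_exp_neg (c * q)
      calc Real.exp (c * q) * (1 - c * q) ≤ Real.exp (c * q) * Real.exp (-(c * q)) := by gcongr
        _ = 1 := by rw [← Real.exp_add]; simp
    have h5 : 0 < 1 - 2 * (c * (1 + 2 * c * q)) * S := by linarith
    have h6 : 0 < 1 - 2 * c * (q + S) := by linarith
    have h7 : 0 < 1 - c * q := by linarith
    calc 4 * Real.exp (c * q) * (4 ^ d / (1 - 2 * (c * (1 + 2 * c * q)) * S))
        ≤ 4 * (1 / (1 - c * q)) * (4 ^ d / (1 - 2 * (c * (1 + 2 * c * q)) * S)) := by gcongr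
      _ = 4 ^ (d + 1) * (1 / ((1 - c * q) * (1 - 2 * (c * (1 + 2 * c * q)) * S))) := by
        field_simp; ring
      _ ≤ 4 ^ (d + 1) * (1 / (1 - 2 * c * (q + S))) := by
        gcongr
        -- With `A = c q` and `B = 2 c S`, the denominators differ by `(1 - A)(1 - (1 + 2A)B) - (1 -
        -- 2A - B) = A(1 - B) + 2A²B ≥ 0`.
        rw [show 2 * (c * (1 + 2 * c * q)) * S = (1 + 2 * (c * q)) * (2 * c * S) by ring,
          show 2 * c * (q + S) = 2 * (c * q) + 2 * c * S by ring]
        nlinarith [mul_nonneg hA0 (sub_nonneg.2 hB1.le), mul_nonneg (mul_nonneg hA0 hA0) hB0]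
      _ = _ := by ring

/-! ### Nets and operator-norm tail bounds -/

/-- A finite set of at most `25 ^ d` vectors in the unit ball of `ℂ^d` that controls operator
norms. -/
lemma exists_norming_finset (d : ℕ) : ∃ N : Finset (EuclideanSpace ℂ (Fin d)),
    N.card ≤ 25 ^ d ∧ (∀ x ∈ N, ‖x‖ ≤ 1) ∧
    ∀ (A : EuclideanSpace ℂ (Fin d) →L[ℂ] EuclideanSpace ℂ (Fin d)) (t : ℝ),
      0 ≤ t → (∀ x ∈ N, ∀ y ∈ N, (inner ℂ x (A y)).re ≤ t) → ‖A‖ ≤ 4 * t := by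
  classical
  set E := EuclideanSpace ℂ (Fin d)
  -- Radius 2 and separation 1 match the Besicovitch packing bound, 5 to the power of the real
  -- dimension `2 * d`. A separated set of largest cardinality is a 1-net of this ball; halved, it
  -- is a 1/2-net of the unit ball.
  let good : Finset E → Prop := fun s =>
    (∀ c ∈ s, ‖c‖ ≤ 2) ∧ ∀ c ∈ s, ∀ e ∈ s, c ≠ e → 1 ≤ ‖c - e‖
  have hcard : ∀ s, good s → s.card ≤ 25 ^ d := by
    intro s hs
    have h := Besicovitch.card_le_of_separated s hs.1 hs.2
    have hfin : Module.finrank ℝ E = 2 * d := by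
      rw [finrank_real_of_complex, finrank_euclideanSpace_fin]
    rw [hfin, pow_mul] at h
    simpa using h
  obtain ⟨s, hs, hmax⟩ : ∃ s, good s ∧ ∀ s', good s' → s'.card ≤ s.card := by
    have hne : ∃ n, ∃ s, good s ∧ s.card = n := ⟨0, ∅, by simp [good], rfl⟩
    have hb : ∀ n, (∃ s, good s ∧ s.card = n) → n ≤ 25 ^ d := by
      rintro n ⟨s, hs, rfl⟩; exact hcard s hs
    obtain ⟨s, hs, hc⟩ := Nat.findGreatest_spec (P := fun n => ∃ s, good s ∧ s.card = n)
      (hb _ hne.choose_spec) hne.choose_spec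
    refine ⟨s, hs, fun s' hs' => ?_⟩
    rw [hc]
    exact Nat.le_findGreatest (hcard s' hs') ⟨s', hs', rfl⟩
  have hnet : ∀ x : E, ‖x‖ ≤ 2 → ∃ c ∈ s, ‖x - c‖ ≤ 1 := by
    intro x hx
    by_contra! hcon
    have hxs : x ∉ s := fun hxs => by
      have := hcon x hxs
      simp at this
      linarith
    have hgood : good (insert x s) := by
      refine ⟨?_, ?_⟩
      · intro c hc
        rcases Finset.mem_insert.1 hc with rfl | hc
        exacts [hx, hs.1 c hc]
      · intro c hc e he hce
        rcases Finset.mem_insert.1 hc with hcx | hcs <;>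
          rcases Finset.mem_insert.1 he with hex | hes
        · exact absurd (hcx.trans hex.symm) hce
        · rw [hcx]; exact (hcon e hes).le
        · rw [hex, norm_sub_rev]; exact (hcon c hcs).le
        · exact hs.2 c hcs e hes hce
    have := hmax _ hgood
    rw [Finset.card_insert_of_notMem hxs] at this
    omega
  have hnet' : ∀ x : E, ‖x‖ ≤ 1 → ∃ c ∈ s, ‖x - (2 : ℂ)⁻¹ • c‖ ≤ 1 / 2 := by
    intro x hx
    obtain ⟨c, hc, h⟩ := hnet ((2 : ℂ) • x) (by rw [norm_smul]; simpa using by linarith)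
    refine ⟨c, hc, ?_⟩
    rw [show x - (2 : ℂ)⁻¹ • c = (2 : ℂ)⁻¹ • ((2 : ℂ) • x - c) by
      rw [smul_sub, smul_smul]; simp, norm_smul]
    norm_num
    linarith
  have hs1 : ∀ c ∈ s, ‖(2 : ℂ)⁻¹ • c‖ ≤ 1 := by
    intro c hc
    have := hs.1 c hc
    rw [norm_smul]
    norm_num
    linarith
  refine ⟨s.image fun c => (2 : ℂ)⁻¹ • c, Finset.card_image_le.trans (hcard s hs), ?_, ?_⟩
  · intro x hx
    obtain ⟨c, hc, rfl⟩ := Finset.mem_image.1 hx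
    exact hs1 c hc
  intro A t ht0 hA
  -- Testing the image against the net point nearest to its own direction loses at most half of its
  -- norm. Approximating the input by the net then loses another factor of two.
  have h1 : ∀ c ∈ s, ‖A ((2 : ℂ)⁻¹ • c)‖ ≤ 2 * t := by
    intro c hc
    set z := A ((2 : ℂ)⁻¹ • c) with hz
    rcases eq_or_ne z 0 with h0 | h0
    · rw [h0, norm_zero]; positivity
    have hzn : 0 < ‖z‖ := norm_pos_iff.2 h0
    set u : E := ((‖z‖⁻¹ : ℝ) : ℂ) • z with hu
    have hun : ‖u‖ = 1 := by rw [hu, norm_smul]; simp [hzn.ne']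
    obtain ⟨b, hb, hub⟩ := hnet' u hun.le
    have hre : (inner ℂ u z).re = ‖z‖ := by
      rw [hu, inner_smul_left, inner_self_eq_norm_sq_to_K]
      simp only [Complex.conj_ofReal, Complex.coe_algebraMap]
      rw [← Complex.ofReal_pow, ← Complex.ofReal_mul, Complex.ofReal_re]
      field_simp
    have h2 : (inner ℂ u z).re =
        (inner ℂ ((2 : ℂ)⁻¹ • b) z).re + (inner ℂ (u - (2 : ℂ)⁻¹ • b) z).re := by
      rw [← Complex.add_re, ← inner_add_left]; simp
    have h3 : (inner ℂ (u - (2 : ℂ)⁻¹ • b) z).re ≤ 1 / 2 * ‖z‖ :=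
      (Complex.re_le_norm _).trans ((norm_inner_le_norm _ _).trans (by gcongr))
    have h4 := hA _ (Finset.mem_image_of_mem _ hb) _ (Finset.mem_image_of_mem _ hc)
    rw [← hz] at h4
    linarith
  have h2 : ∀ y : E, ‖y‖ = 1 → ‖A y‖ ≤ 2 * t + 1 / 2 * ‖A‖ := by
    intro y hy
    obtain ⟨c, hc, h⟩ := hnet' y hy.le
    calc ‖A y‖ = ‖A ((2 : ℂ)⁻¹ • c) + A (y - (2 : ℂ)⁻¹ • c)‖ := by rw [← map_add]; simp
      _ ≤ ‖A ((2 : ℂ)⁻¹ • c)‖ + ‖A (y - (2 : ℂ)⁻¹ • c)‖ := norm_add_le _ _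
      _ ≤ 2 * t + ‖A‖ * (1 / 2) := by
        gcongr
        · exact h1 c hc
        · exact (A.le_opNorm _).trans (by gcongr)
      _ = _ := by ring
  have h3 : ‖A‖ ≤ 2 * t + 1 / 2 * ‖A‖ := by
    refine A.opNorm_le_of_unit_norm (by positivity) h2
  linarith

/-- A union bound over a net turns exponential moments of `Re ⟪x, A y⟫` into a tail bound for the
operator norm of a random operator `A` on `ℂ^d`. -/
lemma sum_opNorm_gt_le {d : ℕ} {Ω : Type*} [Fintype Ω] (p : Ω → ℝ) (hp : ∀ ω, 0 ≤ p ω)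
    (A : Ω → EuclideanSpace ℂ (Fin d) →L[ℂ] EuclideanSpace ℂ (Fin d)) (n τ : ℝ) (hn : 0 ≤ n)
    (hτ0 : 0 ≤ τ) (hτ1 : τ ≤ 1)
    (h : ∀ μ : ℝ, 0 ≤ μ → μ ≤ 1 / 48 → ∀ x y, ‖x‖ ≤ 1 → ‖y‖ ≤ 1 →
      ∑ ω, p ω * Real.exp (n * μ * (inner ℂ x (A ω y)).re) ≤ Real.exp (84000 * n * μ ^ 2)) :
    ∑ ω, p ω * {ω | τ < ‖A ω‖}.indicator 1 ω ≤ 625 ^ d * Real.exp (-(n * τ ^ 2 / 5376000)) := by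
  classical
  obtain ⟨N, hcard, hball, hN⟩ := exists_norming_finset d
  -- The minimizer of `84000 μ² - μ τ / 4`, with minimum `-τ² / 5376000`.
  set μ : ℝ := τ / 672000 with hμ
  have hμ0 : 0 ≤ μ := by positivity
  have hpt : ∀ ω, p ω * {ω | τ < ‖A ω‖}.indicator 1 ω ≤
      ∑ x ∈ N, ∑ y ∈ N, Real.exp (-(n * μ * (τ / 4))) *
        (p ω * Real.exp (n * μ * (inner ℂ x (A ω y)).re)) := by
    intro ω
    have hnn : ∀ x y, 0 ≤ Real.exp (-(n * μ * (τ / 4))) *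
        (p ω * Real.exp (n * μ * (inner ℂ x (A ω y)).re)) := fun x y =>
      mul_nonneg (Real.exp_pos _).le (mul_nonneg (hp ω) (Real.exp_pos _).le)
    by_cases hω : τ < ‖A ω‖
    · have : ∃ x ∈ N, ∃ y ∈ N, τ / 4 < (inner ℂ x (A ω y)).re := by
        by_contra! hcon
        have := hN (A ω) (τ / 4) (by positivity) hcon
        linarith
      obtain ⟨x, hx, y, hy, hxy⟩ := this
      rw [Set.indicator_of_mem (by exact hω)]
      refine le_trans ?_ (Finset.single_le_sum (f := fun x => ∑ y ∈ N,
        Real.exp (-(n * μ * (τ / 4))) * (p ω * Real.exp (n * μ * (inner ℂ x (A ω y)).re)))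
        (fun x _ => Finset.sum_nonneg fun y _ => hnn x y) hx)
      refine le_trans ?_ (Finset.single_le_sum (f := fun y =>
        Real.exp (-(n * μ * (τ / 4))) * (p ω * Real.exp (n * μ * (inner ℂ x (A ω y)).re)))
        (fun y _ => hnn x y) hy)
      rw [mul_left_comm, ← Real.exp_add]
      refine mul_le_mul_of_nonneg_left ?_ (hp ω)
      rw [Pi.one_apply, Real.one_le_exp_iff]
      have : n * μ * (τ / 4) ≤ n * μ * (inner ℂ x (A ω y)).re := by gcongr
      linarith
    · rw [Set.indicator_of_notMem (by exact hω), mul_zero]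
      exact Finset.sum_nonneg fun x _ => Finset.sum_nonneg fun y _ => hnn x y
  calc ∑ ω, p ω * {ω | τ < ‖A ω‖}.indicator 1 ω
      ≤ ∑ ω, ∑ x ∈ N, ∑ y ∈ N, Real.exp (-(n * μ * (τ / 4))) *
        (p ω * Real.exp (n * μ * (inner ℂ x (A ω y)).re)) := Finset.sum_le_sum fun ω _ => hpt ω
    _ = ∑ x ∈ N, ∑ y ∈ N, Real.exp (-(n * μ * (τ / 4))) *
        ∑ ω, p ω * Real.exp (n * μ * (inner ℂ x (A ω y)).re) := by
      rw [Finset.sum_comm]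
      refine Finset.sum_congr rfl fun x _ => ?_
      rw [Finset.sum_comm]
      exact Finset.sum_congr rfl fun y _ => (Finset.mul_sum _ _ _).symm
    _ ≤ ∑ x ∈ N, ∑ y ∈ N, Real.exp (-(n * μ * (τ / 4))) * Real.exp (84000 * n * μ ^ 2) := by
      refine Finset.sum_le_sum fun x hx => Finset.sum_le_sum fun y hy =>
        mul_le_mul_of_nonneg_left ?_ (Real.exp_pos _).le
      exact h μ hμ0 (by rw [hμ]; linarith) x y (hball x hx) (hball y hy)
    _ = (N.card : ℝ) * N.card * Real.exp (-(n * τ ^ 2 / 5376000)) := by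
      rw [Finset.sum_const, Finset.sum_const, ← Real.exp_add, nsmul_eq_mul, nsmul_eq_mul, ← mul_assoc]
      congr 2
      rw [hμ]; ring
    _ ≤ (25 ^ d : ℝ) * 25 ^ d * Real.exp (-(n * τ ^ 2 / 5376000)) := by
      have : (N.card : ℝ) ≤ 25 ^ d := by exact_mod_cast hcard
      gcongr
    _ = _ := by rw [← mul_pow]; norm_num

/-! ### From exponential moments to sub-Gaussian bounds -/

lemma exp_le_one_add_add_sq_mul (t c : ℝ) (a : ℝ) (hc : 0 < c) (ha0 : 0 ≤ a) (ha : a ≤ c / 2) :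
    Real.exp (a * t) ≤ 1 + a * t + a ^ 2 * (8 / c ^ 2) * Real.exp (c * |t|) := by
  have h1 : Real.exp (a * t) - 1 - a * t ≤ |a * t| ^ 2 * Real.exp |a * t| := by
    have := Complex.norm_exp_sub_sum_le_norm_mul_exp ((a * t : ℝ) : ℂ) 2
    rw [show Complex.exp ((a * t : ℝ) : ℂ) -
      ∑ m ∈ Finset.range 2, ((a * t : ℝ) : ℂ) ^ m / (m.factorial : ℂ) =
      ((Real.exp (a * t) - 1 - a * t : ℝ) : ℂ) by
        simp [Finset.sum_range_succ]; ring] at this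
    rw [Complex.norm_real, Complex.norm_real] at this
    exact (le_abs_self _).trans this
  -- Half of the available exponent absorbs the factor `t²` of the Taylor remainder; the other half
  -- absorbs `exp |a * t|`.
  have h2 : (c / 2 * |t|) ^ 2 / 2 ≤ Real.exp (c / 2 * |t|) :=
    (Real.quadratic_le_exp_of_nonneg (by positivity)).trans' (by
      have : 0 ≤ c / 2 * |t| := by positivity
      linarith)
  have h3 : Real.exp |a * t| ≤ Real.exp (c / 2 * |t|) := by
    rw [abs_mul, abs_of_nonneg ha0]; gcongr
  have h4 : |a * t| ^ 2 = a ^ 2 * (8 / c ^ 2) * ((c / 2 * |t|) ^ 2 / 2) := by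
    rw [abs_mul, abs_of_nonneg ha0]; field_simp; norm_num
  have h5 : Real.exp (c * |t|) = Real.exp (c / 2 * |t|) * Real.exp (c / 2 * |t|) := by
    rw [← Real.exp_add]; ring_nf
  have : |a * t| ^ 2 * Real.exp |a * t| ≤ a ^ 2 * (8 / c ^ 2) * Real.exp (c * |t|) := by
    rw [h4, h5, ← mul_assoc]; gcongr
  linarith

/-- A centred random variable with a bounded exponential moment has a sub-Gaussian moment
generating function near zero. -/
lemma sum_exp_le_of_exp_moment {Ω : Type*} [Fintype Ω] (p X : Ω → ℝ) (hp : ∀ ω, 0 ≤ p ω)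
    (hp1 : ∑ ω, p ω = 1) (hX : ∑ ω, p ω * X ω = 0) (c K a : ℝ) (hc : 0 < c)
    (hK : ∑ ω, p ω * Real.exp (c * |X ω|) ≤ K) (ha0 : 0 ≤ a) (ha : a ≤ c / 2) :
    ∑ ω, p ω * Real.exp (a * X ω) ≤ Real.exp (8 / c ^ 2 * K * a ^ 2) := by
  calc ∑ ω, p ω * Real.exp (a * X ω)
      ≤ ∑ ω, p ω * (1 + a * X ω + a ^ 2 * (8 / c ^ 2) * Real.exp (c * |X ω|)) :=
        Finset.sum_le_sum fun ω _ => mul_le_mul_of_nonneg_left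
          (exp_le_one_add_add_sq_mul _ c a hc ha0 ha) (hp ω)
    _ = ∑ ω, p ω + a * ∑ ω, p ω * X ω +
        a ^ 2 * (8 / c ^ 2) * ∑ ω, p ω * Real.exp (c * |X ω|) := by
      rw [Finset.mul_sum, Finset.mul_sum, ← Finset.sum_add_distrib, ← Finset.sum_add_distrib]
      exact Finset.sum_congr rfl fun ω _ => by ring
    _ ≤ 1 + a ^ 2 * (8 / c ^ 2) * K := by rw [hp1, hX, mul_zero, add_zero]; gcongr
    _ ≤ _ := by
      have := Real.add_one_le_exp (8 / c ^ 2 * K * a ^ 2)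
      linarith

/-! ### The randomized measurement bases -/

/-- The primitive `d`-th root of unity `exp (2πi / d)`. -/
def rootOfUnity (d : ℕ) : ℂ := Complex.exp (2 * Real.pi * Complex.I / d)

lemma isPrimitiveRoot_rootOfUnity (d : ℕ) [NeZero d] : IsPrimitiveRoot (rootOfUnity d) d :=
  Complex.isPrimitiveRoot_exp d (NeZero.ne d)

lemma star_mul_self_of_norm_eq_one {z : ℂ} (h : ‖z‖ = 1) : star z * z = 1 := by
  have : star z * z = ((‖z‖ ^ 2 : ℝ) : ℂ) := by
    rw [Complex.sq_norm]; exact Complex.normSq_eq_conj_mul_self.symm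
  rw [this, h]; simp

lemma norm_rootOfUnity_pow (d : ℕ) [NeZero d] (n : ℕ) : ‖rootOfUnity d ^ n‖ = 1 := by
  rw [norm_pow, (isPrimitiveRoot_rootOfUnity d).norm'_eq_one (NeZero.ne d), one_pow]

lemma sum_star_rootOfUnity_mul {d : ℕ} [NeZero d] (k l : Fin d) :
    ∑ i : Fin d, star (rootOfUnity d ^ (i * k : ℕ)) * rootOfUnity d ^ (i * l : ℕ) =
      if k = l then (d : ℂ) else 0 := by
  split_ifs with h
  · subst h
    rw [Finset.sum_congr rfl fun (i : Fin d) _ =>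
      star_mul_self_of_norm_eq_one (norm_rootOfUnity_pow d (i * k))]
    simp
  · set ζ := rootOfUnity d
    have hζ : IsPrimitiveRoot ζ d := isPrimitiveRoot_rootOfUnity d
    set q : ℂ := star (ζ ^ (k : ℕ)) * ζ ^ (l : ℕ) with hq
    have hk : star (ζ ^ (k : ℕ)) * ζ ^ (k : ℕ) = 1 :=
      star_mul_self_of_norm_eq_one (norm_rootOfUnity_pow d _)
    have hq1 : q ≠ 1 := by
      intro h1
      have h2 : ζ ^ (l : ℕ) = ζ ^ (k : ℕ) := by
        have hne : star (ζ ^ (k : ℕ)) ≠ 0 := left_ne_zero_of_mul_eq_one hk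
        exact mul_left_cancel₀ hne (by rw [hk, ← hq, h1])
      exact h (Fin.ext (hζ.pow_inj k.2 l.2 h2.symm))
    have hqd : q ^ d = 1 := by
      rw [hq, mul_pow, ← star_pow, ← pow_mul, ← pow_mul, mul_comm (k : ℕ), mul_comm (l : ℕ),
        pow_mul, pow_mul, hζ.pow_eq_one]
      simp
    have hsum : ∑ i : Fin d, star (ζ ^ (i * k : ℕ)) * ζ ^ (i * l : ℕ) =
        ∑ i ∈ Finset.range d, q ^ i := by
      rw [← Fin.sum_univ_eq_sum_range]
      refine Finset.sum_congr rfl fun i _ => ?_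
      rw [hq, mul_pow, ← star_pow, ← pow_mul, ← pow_mul, mul_comm (k : ℕ), mul_comm (l : ℕ)]
    rw [hsum]
    have := geom_sum_mul q d
    rw [hqd, sub_self] at this
    exact (mul_eq_zero.1 this).resolve_right (sub_ne_zero.2 hq1)

/-- The vector with unimodular entries `I ^ w i * ζ ^ (i * k)`. -/
def flatVec {d : ℕ} (w : Fin d → Fin 4) (k : Fin d) : EuclideanSpace ℂ (Fin d) :=
  WithLp.toLp 2 fun i => Complex.I ^ (w i : ℕ) * rootOfUnity d ^ (i * k : ℕ)

lemma sum_star_flatVec_mul {d : ℕ} [NeZero d] (w : Fin d → Fin 4) (k l : Fin d) :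
    ∑ i, star (flatVec w k i) * flatVec w l i = if k = l then (d : ℂ) else 0 := by
  rw [← sum_star_rootOfUnity_mul k l]
  refine Finset.sum_congr rfl fun i _ => ?_
  have h : star (Complex.I ^ (w i : ℕ)) * Complex.I ^ (w i : ℕ) = 1 :=
    star_mul_self_of_norm_eq_one (by simp)
  simp only [flatVec, star_mul]
  linear_combination (star (rootOfUnity d ^ (i * k : ℕ)) * rootOfUnity d ^ (i * l : ℕ)) * h

/-- The classical randomness of one trial: a coin that chooses between the computational basis and
a basis of flat vectors, and the phases of the flat vectors. -/
abbrev TrialSeed (d : ℕ) : Type := Bool × (Fin d → Fin 4)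

/-- The matrix that rotates the measurement basis chosen by the seed to the computational basis. -/
def measMatrix {d : ℕ} (s : TrialSeed d) : Matrix (Fin d) (Fin d) ℂ :=
  if s.1 then Matrix.of fun k i => ((Real.sqrt d)⁻¹ : ℝ) * star (flatVec s.2 k i) else 1

lemma measMatrix_mem {d : ℕ} [NeZero d] (s : TrialSeed d) :
    measMatrix s ∈ Matrix.unitaryGroup (Fin d) ℂ := by
  obtain ⟨β, w⟩ := s
  cases β
  · simp [measMatrix]
  rw [Matrix.mem_unitaryGroup_iff]
  have hd : (0 : ℝ) < d := by exact_mod_cast Nat.pos_of_ne_zero (NeZero.ne d)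
  ext k l
  have hs : (((Real.sqrt d)⁻¹ : ℝ) : ℂ) * ((Real.sqrt d)⁻¹ : ℝ) * (d : ℂ) = 1 := by
    rw [← Complex.ofReal_natCast, ← Complex.ofReal_mul, ← Complex.ofReal_mul, ← mul_inv,
      Real.mul_self_sqrt hd.le, inv_mul_cancel₀ hd.ne', Complex.ofReal_one]
  have e : (measMatrix (true, w) * star (measMatrix (true, w))) k l =
      (((Real.sqrt d)⁻¹ : ℝ) : ℂ) * ((Real.sqrt d)⁻¹ : ℝ) *
        ∑ i, star (flatVec w k i) * flatVec w l i := by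
    rw [Matrix.mul_apply, Finset.mul_sum]
    refine Finset.sum_congr rfl fun i _ => ?_
    simp only [measMatrix, if_true, Matrix.star_apply, Matrix.of_apply, star_mul, star_star]
    rw [show star (((Real.sqrt d)⁻¹ : ℝ) : ℂ) = (((Real.sqrt d)⁻¹ : ℝ) : ℂ) from
      Complex.conj_ofReal _]
    ring
  rw [e, sum_star_flatVec_mul, Matrix.one_apply]
  split_ifs
  · exact hs
  · simp

/-- `measMatrix` as an element of `U(d)`. -/
def measUnitary {d : ℕ} [NeZero d] (s : TrialSeed d) : UU d := ⟨measMatrix s, measMatrix_mem s⟩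

lemma toEuclideanCLM_mem_unitary {d : ℕ} (U : UU d) :
    Matrix.toEuclideanCLM (𝕜 := ℂ) (U : Matrix (Fin d) (Fin d) ℂ) ∈
      unitary (EuclideanSpace ℂ (Fin d) →L[ℂ] EuclideanSpace ℂ (Fin d)) :=
  Unitary.map_mem (Matrix.toEuclideanCLM (n := Fin d) (𝕜 := ℂ)) U.2

lemma norm_toEuclideanCLM_apply {d : ℕ} (U : UU d) (x : EuclideanSpace ℂ (Fin d)) :
    ‖Matrix.toEuclideanCLM (𝕜 := ℂ) (U : Matrix (Fin d) (Fin d) ℂ) x‖ = ‖x‖ :=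
  ContinuousLinearMap.norm_map_of_mem_unitary (toEuclideanCLM_mem_unitary U) x

lemma inner_toEuclideanCLM_apply {d : ℕ} (U : UU d) (x y : EuclideanSpace ℂ (Fin d)) :
    inner ℂ (Matrix.toEuclideanCLM (𝕜 := ℂ) (U : Matrix (Fin d) (Fin d) ℂ) x)
      (Matrix.toEuclideanCLM (𝕜 := ℂ) (U : Matrix (Fin d) (Fin d) ℂ) y) = inner ℂ x y :=
  ContinuousLinearMap.inner_map_map_of_mem_unitary (toEuclideanCLM_mem_unitary U) x y

lemma sum_norm_mulVec_sq {d : ℕ} (U : UU d) (x : EuclideanSpace ℂ (Fin d)) :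
    ∑ k, ‖(U : Matrix (Fin d) (Fin d) ℂ).mulVec x k‖ ^ 2 = ‖x‖ ^ 2 := by
  rw [← norm_toEuclideanCLM_apply U x, EuclideanSpace.norm_sq_eq]
  simp [Matrix.ofLp_toEuclideanCLM]

/-! ### Mean and exponential moment of a single trial -/

/-- The joint probability of the seed and the outcome of a trial on the state `v`. -/
def trialProb {d : ℕ} (v : EuclideanSpace ℂ (Fin d)) (ω : TrialSeed d × Fin d) : ℝ :=
  (2 * 4 ^ d)⁻¹ * ‖(measMatrix ω.1).mulVec v ω.2‖ ^ 2

/-- The operator computed from a trial. Its mean is the projection onto the state. -/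
def sampleOp {d : ℕ} (ω : TrialSeed d × Fin d) :
    EuclideanSpace ℂ (Fin d) →L[ℂ] EuclideanSpace ℂ (Fin d) :=
  if ω.1.1 then
    (2 : ℂ) • (InnerProductSpace.rankOne ℂ (flatVec ω.1.2 ω.2) (flatVec ω.1.2 ω.2) - 1)
  else (2 : ℂ) • InnerProductSpace.rankOne ℂ (EuclideanSpace.single ω.2 (1 : ℂ))
    (EuclideanSpace.single ω.2 (1 : ℂ))

lemma trialProb_nonneg {d : ℕ} (v : EuclideanSpace ℂ (Fin d)) (ω : TrialSeed d × Fin d) :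
    0 ≤ trialProb v ω := by
  unfold trialProb; positivity

lemma sum_trialProb {d : ℕ} [NeZero d] (v : EuclideanSpace ℂ (Fin d)) (hv : ‖v‖ = 1) :
    ∑ ω, trialProb v ω = 1 := by
  rw [Fintype.sum_prod_type]
  have h : ∀ s : TrialSeed d, ∑ k, trialProb v (s, k) = (2 * 4 ^ d)⁻¹ := by
    intro s
    simp only [trialProb]
    rw [← Finset.mul_sum]
    have := sum_norm_mulVec_sq (measUnitary s) v
    simp only [measUnitary] at this
    rw [this, hv]; simp
  rw [Finset.sum_congr rfl fun s _ => h s]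
  simp
  field_simp

/-- `x` with its phases shifted by those of the `k`-th Fourier vector. -/
def fourierTwist {d : ℕ} (k : Fin d) (x : EuclideanSpace ℂ (Fin d)) : Fin d → ℂ :=
  fun i => star (rootOfUnity d ^ (i * k : ℕ)) * x i

/-- The Fourier phases move onto `x`. Since they preserve all products `x i * star (y i)`, the
moments of the phase sums are the same for every outcome `k`. -/
lemma inner_flatVec {d : ℕ} (w : Fin d → Fin 4) (k : Fin d) (x : EuclideanSpace ℂ (Fin d)) :
    inner ℂ (flatVec w k) x = phaseSum w (fourierTwist k x) := by
  simp only [PiLp.inner_apply, RCLike.inner_apply, phaseSum, fourierTwist, flatVec]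
  refine Finset.sum_congr rfl fun i _ => ?_
  rw [map_mul]
  simp only [Complex.star_def]
  ring

lemma sum_fourierTwist_mul_star {d : ℕ} [NeZero d] (k : Fin d) (x y : EuclideanSpace ℂ (Fin d)) :
    ∑ i, fourierTwist k x i * star (fourierTwist k y i) = inner ℂ y x := by
  simp only [PiLp.inner_apply, RCLike.inner_apply, fourierTwist, star_mul, star_star]
  refine Finset.sum_congr rfl fun i _ => ?_
  have := star_mul_self_of_norm_eq_one (norm_rootOfUnity_pow d (i * k))
  rw [Complex.star_def] at *
  linear_combination (x i * (starRingEnd ℂ) (y i)) * this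

lemma sum_norm_fourierTwist_sq {d : ℕ} [NeZero d] (k : Fin d) (x : EuclideanSpace ℂ (Fin d)) :
    ∑ i, ‖fourierTwist k x i‖ ^ 2 = ‖x‖ ^ 2 := by
  rw [EuclideanSpace.norm_sq_eq]
  simp only [fourierTwist, norm_mul, norm_star, norm_rootOfUnity_pow, one_mul]

lemma fourierTwist_mul_star {d : ℕ} [NeZero d] (k i : Fin d) (x y : EuclideanSpace ℂ (Fin d)) :
    fourierTwist k x i * star (fourierTwist k y i) = x i * star (y i) := by
  have := star_mul_self_of_norm_eq_one (norm_rootOfUnity_pow d (i * k))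
  simp only [fourierTwist, star_mul, star_star]
  linear_combination (x i * star (y i)) * this

lemma norm_measMatrix_true_sq {d : ℕ} [NeZero d] (w : Fin d → Fin 4) (k : Fin d)
    (v : EuclideanSpace ℂ (Fin d)) :
    ‖(measMatrix (true, w)).mulVec v k‖ ^ 2 = (d : ℝ)⁻¹ * ‖inner ℂ (flatVec w k) v‖ ^ 2 := by
  have e : (measMatrix (true, w)).mulVec v k =
      ((Real.sqrt d)⁻¹ : ℝ) * inner ℂ (flatVec w k) v := by
    simp only [Matrix.mulVec, dotProduct, measMatrix, if_true, Matrix.of_apply, PiLp.inner_apply,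
      RCLike.inner_apply, Finset.mul_sum]
    refine Finset.sum_congr rfl fun i _ => ?_
    simp only [Complex.star_def]
    ring
  rw [e, norm_mul, mul_pow, Complex.norm_real, Real.norm_eq_abs, sq_abs, inv_pow,
    Real.sq_sqrt (Nat.cast_nonneg d)]

lemma norm_measMatrix_false_sq {d : ℕ} (w : Fin d → Fin 4) (k : Fin d)
    (v : EuclideanSpace ℂ (Fin d)) :
    ‖(measMatrix (false, w)).mulVec v k‖ ^ 2 = ‖v k‖ ^ 2 := by
  simp [measMatrix]

lemma sum_trial {M : Type*} [AddCommMonoid M] {d : ℕ} (f : TrialSeed d × Fin d → M) :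
    ∑ ω, f ω = (∑ k : Fin d, ∑ w : Fin d → Fin 4, f ((true, w), k)) +
      ∑ k : Fin d, ∑ w : Fin d → Fin 4, f ((false, w), k) := by
  rw [Fintype.sum_prod_type, Fintype.sum_prod_type, Fintype.sum_bool,
    Finset.sum_comm (γ := Fin d → Fin 4), Finset.sum_comm (γ := Fin d → Fin 4)]

lemma inner_sampleOp_true {d : ℕ} (w : Fin d → Fin 4) (k : Fin d)
    (x y : EuclideanSpace ℂ (Fin d)) :
    inner ℂ x (sampleOp ((true, w), k) y) =
      2 * (inner ℂ x (flatVec w k) * inner ℂ (flatVec w k) y - inner ℂ x y) := by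
  simp [sampleOp]
  ring

lemma inner_sampleOp_false {d : ℕ} (w : Fin d → Fin 4) (k : Fin d)
    (x y : EuclideanSpace ℂ (Fin d)) :
    inner ℂ x (sampleOp ((false, w), k) y) = 2 * (y k * star (x k)) := by
  simp [sampleOp, EuclideanSpace.inner_single_left,
    EuclideanSpace.inner_single_right]

/-- By `sum_phaseSum_fourth` the flat half contributes `|v⟩⟨v|` without its diagonal, once the
identity is subtracted; the computational half restores the diagonal. The factors 2 in `sampleOp`
undo the coin. -/
lemma sum_trialProb_mul_inner {d : ℕ} [NeZero d] (v x y : EuclideanSpace ℂ (Fin d))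
    (hv : ‖v‖ = 1) :
    ∑ ω, (trialProb v ω : ℂ) * inner ℂ x (sampleOp ω y) = inner ℂ x v * inner ℂ v y := by
  have hd : (d : ℂ) ≠ 0 := by exact_mod_cast NeZero.ne d
  have hvv : inner ℂ v v = (1 : ℂ) := by rw [inner_self_eq_norm_sq_to_K, hv]; simp
  have hsq : ∀ z : ℂ, ((‖z‖ ^ 2 : ℝ) : ℂ) = z * star z := fun z => by
    rw [Complex.sq_norm]; exact (Complex.mul_conj z).symm
  have h4 : (4 : ℂ) ^ d ≠ 0 := pow_ne_zero _ (by norm_num)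
  have hT : ∀ k : Fin d, ∑ w : Fin d → Fin 4,
      (trialProb v ((true, w), k) : ℂ) * inner ℂ x (sampleOp ((true, w), k) y) =
      (d : ℂ)⁻¹ * (inner ℂ x v * inner ℂ v y - ∑ i, v i * star (v i) * (y i * star (x i))) := by
    intro k
    have e : ∀ w : Fin d → Fin 4,
        (trialProb v ((true, w), k) : ℂ) * inner ℂ x (sampleOp ((true, w), k) y) =
        (4 ^ d : ℂ)⁻¹ * (d : ℂ)⁻¹ * (phaseSum w (fourierTwist k v) *
          star (phaseSum w (fourierTwist k v)) * (phaseSum w (fourierTwist k y) *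
          star (phaseSum w (fourierTwist k x)))) -
        (4 ^ d : ℂ)⁻¹ * (d : ℂ)⁻¹ * inner ℂ x y * (phaseSum w (fourierTwist k v) *
          star (phaseSum w (fourierTwist k v))) := by
      intro w
      rw [inner_sampleOp_true, trialProb, norm_measMatrix_true_sq]
      rw [Complex.ofReal_mul, Complex.ofReal_mul, hsq]
      rw [← inner_conj_symm x (flatVec w k)]
      simp only [inner_flatVec]
      rw [← Complex.star_def]
      push_cast
      rw [mul_inv]
      ring
    rw [Finset.sum_congr rfl fun w _ => e w, Finset.sum_sub_distrib, ← Finset.mul_sum,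
      ← Finset.mul_sum, sum_phaseSum_fourth, sum_phaseSum_mul_star]
    simp only [sum_fourierTwist_mul_star]
    simp only [fourierTwist_mul_star, hvv]
    field_simp
    ring
  have hF : ∀ k : Fin d, ∑ w : Fin d → Fin 4,
      (trialProb v ((false, w), k) : ℂ) * inner ℂ x (sampleOp ((false, w), k) y) =
      v k * star (v k) * (y k * star (x k)) := by
    intro k
    simp only [inner_sampleOp_false, trialProb, norm_measMatrix_false_sq]
    rw [Complex.ofReal_mul, hsq]
    simp
    field_simp
  rw [sum_trial, Finset.sum_congr rfl fun k _ => hT k, Finset.sum_congr rfl fun k _ => hF k]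
  simp only [Finset.sum_const, Finset.card_univ, Fintype.card_fin, nsmul_eq_mul]
  rw [mul_inv_cancel_left₀ hd]
  ring

lemma exp_add_add_le (a b c : ℝ) :
    Real.exp (a + b + c) ≤ (Real.exp (3 * a) + Real.exp (3 * b) + Real.exp (3 * c)) / 3 := by
  have h : ∀ t : ℝ, Real.exp (3 * t) = Real.exp t ^ 3 := fun t => by
    rw [← Real.exp_nat_mul]; norm_num
  rw [h, h, h, Real.exp_add, Real.exp_add]
  have ha := Real.exp_pos a
  have hb := Real.exp_pos b
  have hc := Real.exp_pos c
  nlinarith [mul_nonneg (add_pos (add_pos ha hb) hc).le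
    (add_nonneg (add_nonneg (sq_nonneg (Real.exp a - Real.exp b))
      (sq_nonneg (Real.exp b - Real.exp c))) (sq_nonneg (Real.exp a - Real.exp c)))]

lemma sum_exp_inner_flatVec_sq_le {d : ℕ} [NeZero d] (k : Fin d) (x : EuclideanSpace ℂ (Fin d))
    (hx : ‖x‖ ≤ 1) :
    ∑ w : Fin d → Fin 4, Real.exp (1 / 4 * ‖inner ℂ (flatVec w k) x‖ ^ 2) ≤ 2 * 4 ^ d := by
  have hx2 : ‖x‖ ^ 2 ≤ 1 := by nlinarith [norm_nonneg x]
  have h := sum_exp_phaseSum_sq_le (fourierTwist k x) (1 / 4) (by norm_num)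
    (by rw [sum_norm_fourierTwist_sq]; linarith)
  rw [sum_norm_fourierTwist_sq] at h
  simp only [inner_flatVec]
  refine h.trans ?_
  rw [div_le_iff₀ (by linarith)]
  nlinarith [pow_pos (show (0 : ℝ) < 4 by norm_num) d]

/-- For a flat outcome the Born weight and the matrix element involve three phase sums. Each is
given the exponent `1 / 12`, which the three-term AM-GM inequality `exp_add_add_le` raises to the `1
/ 4` allowed by `sum_exp_inner_flatVec_sq_le`. A computational outcome has a bounded matrix element.
-/
lemma sum_trialProb_mul_exp_le {d : ℕ} [NeZero d] (v x y : EuclideanSpace ℂ (Fin d))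
    (hv : ‖v‖ = 1) (hx : ‖x‖ ≤ 1) (hy : ‖y‖ ≤ 1) :
    ∑ ω, trialProb v ω * Real.exp (1 / 12 * ‖inner ℂ x (sampleOp ω y)‖) ≤ 16 := by
  have hd : (0 : ℝ) < d := by exact_mod_cast Nat.pos_of_ne_zero (NeZero.ne d)
  have h4 : (0 : ℝ) < 4 ^ d := by positivity
  have he : Real.exp (1 / 6) ≤ 6 / 5 := by
    have h1 := Real.one_sub_le_exp_neg (1 / 6)
    have h2 : Real.exp (1 / 6) * Real.exp (-(1 / 6)) = 1 := by rw [← Real.exp_add]; simp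
    nlinarith [Real.exp_pos (1 / 6)]
  have hxy : ‖inner ℂ x y‖ ≤ 1 :=
    (norm_inner_le_norm x y).trans (mul_le_one₀ hx (norm_nonneg _) hy)
  have hT : ∀ k : Fin d, ∑ w : Fin d → Fin 4, trialProb v ((true, w), k) *
      Real.exp (1 / 12 * ‖inner ℂ x (sampleOp ((true, w), k) y)‖) ≤ (d : ℝ)⁻¹ * 15 := by
    intro k
    have hpt : ∀ w : Fin d → Fin 4, trialProb v ((true, w), k) *
        Real.exp (1 / 12 * ‖inner ℂ x (sampleOp ((true, w), k) y)‖) ≤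
        (2 * 4 ^ d)⁻¹ * (d : ℝ)⁻¹ * (24 / 5) *
          (Real.exp (1 / 4 * ‖inner ℂ (flatVec w k) v‖ ^ 2) +
          Real.exp (1 / 4 * ‖inner ℂ (flatVec w k) x‖ ^ 2) +
          Real.exp (1 / 4 * ‖inner ℂ (flatVec w k) y‖ ^ 2)) := by
      intro w
      set V := ‖inner ℂ (flatVec w k) v‖
      set A := ‖inner ℂ (flatVec w k) x‖ with hA
      set B := ‖inner ℂ (flatVec w k) y‖ with hB
      have hnorm : ‖inner ℂ x (sampleOp ((true, w), k) y)‖ ≤ A ^ 2 + B ^ 2 + 2 := by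
        rw [inner_sampleOp_true, norm_mul]
        have h1 : ‖inner ℂ x (flatVec w k) * inner ℂ (flatVec w k) y - inner ℂ x y‖ ≤
            A * B + 1 := by
          refine (norm_sub_le _ _).trans (add_le_add ?_ hxy)
          rw [norm_mul, norm_inner_symm]
        rw [Complex.norm_ofNat]
        nlinarith [sq_nonneg (A - B)]
      -- The Born weight is unbounded in `d`, so it too is traded for an exponential.
      have hV : V ^ 2 ≤ 12 * Real.exp (1 / 12 * V ^ 2) := by
        have := Real.add_one_le_exp (1 / 12 * V ^ 2)
        linarith
      have h3 := exp_add_add_le (1 / 12 * V ^ 2) (1 / 12 * A ^ 2) (1 / 12 * B ^ 2)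
      rw [show 3 * (1 / 12 * V ^ 2) = 1 / 4 * V ^ 2 by ring,
        show 3 * (1 / 12 * A ^ 2) = 1 / 4 * A ^ 2 by ring,
        show 3 * (1 / 12 * B ^ 2) = 1 / 4 * B ^ 2 by ring] at h3
      rw [trialProb, norm_measMatrix_true_sq]
      have h5 : Real.exp (1 / 12 * ‖inner ℂ x (sampleOp ((true, w), k) y)‖) ≤
          Real.exp (1 / 6) * Real.exp (1 / 12 * A ^ 2 + 1 / 12 * B ^ 2) := by
        rw [← Real.exp_add]
        exact Real.exp_le_exp.2 (by linarith)
      have h6 : V ^ 2 * Real.exp (1 / 12 * ‖inner ℂ x (sampleOp ((true, w), k) y)‖) ≤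
          24 / 5 * (Real.exp (1 / 4 * V ^ 2) + Real.exp (1 / 4 * A ^ 2) +
            Real.exp (1 / 4 * B ^ 2)) := by
        calc _ ≤ (12 * Real.exp (1 / 12 * V ^ 2)) *
              (6 / 5 * Real.exp (1 / 12 * A ^ 2 + 1 / 12 * B ^ 2)) := by
              gcongr
              exact h5.trans (by gcongr)
          _ = 72 / 5 * Real.exp (1 / 12 * V ^ 2 + 1 / 12 * A ^ 2 + 1 / 12 * B ^ 2) := by
              rw [add_assoc, Real.exp_add (1 / 12 * V ^ 2)]
              ring
          _ ≤ _ := by linarith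
      calc _ = (2 * 4 ^ d)⁻¹ * (d : ℝ)⁻¹ *
            (V ^ 2 * Real.exp (1 / 12 * ‖inner ℂ x (sampleOp ((true, w), k) y)‖)) := by ring
        _ ≤ (2 * 4 ^ d)⁻¹ * (d : ℝ)⁻¹ * (24 / 5 * (Real.exp (1 / 4 * V ^ 2) +
            Real.exp (1 / 4 * A ^ 2) + Real.exp (1 / 4 * B ^ 2))) := by gcongr
        _ = _ := by ring
    refine (Finset.sum_le_sum fun w _ => hpt w).trans ?_
    rw [← Finset.mul_sum, Finset.sum_add_distrib, Finset.sum_add_distrib]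
    have h1 := sum_exp_inner_flatVec_sq_le k v hv.le
    have h2 := sum_exp_inner_flatVec_sq_le k x hx
    have h3 := sum_exp_inner_flatVec_sq_le k y hy
    calc _ ≤ (2 * 4 ^ d)⁻¹ * (d : ℝ)⁻¹ * (24 / 5) * (2 * 4 ^ d + 2 * 4 ^ d + 2 * 4 ^ d) := by
          gcongr
      _ = (d : ℝ)⁻¹ * (72 / 5) := by field_simp; norm_num
      _ ≤ _ := by gcongr; norm_num
  have hF : ∀ k : Fin d, ∑ w : Fin d → Fin 4, trialProb v ((false, w), k) *
      Real.exp (1 / 12 * ‖inner ℂ x (sampleOp ((false, w), k) y)‖) ≤ ‖v k‖ ^ 2 * 1 := by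
    intro k
    have hk : ‖y k * star (x k)‖ ≤ 1 := by
      rw [norm_mul, norm_star]
      exact mul_le_one₀ ((PiLp.norm_apply_le y k).trans hy) (norm_nonneg _)
        ((PiLp.norm_apply_le x k).trans hx)
    simp only [inner_sampleOp_false, trialProb, norm_measMatrix_false_sq]
    rw [Finset.sum_const, norm_mul, Complex.norm_ofNat]
    have h5 : Real.exp (1 / 12 * (2 * ‖y k * star (x k)‖)) ≤ 2 :=
      (Real.exp_le_exp.2 (by linarith)).trans (he.trans (by norm_num))
    simp only [Finset.card_univ, Fintype.card_fun, Fintype.card_fin, nsmul_eq_mul]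
    push_cast
    calc _ ≤ 4 ^ d * ((2 * 4 ^ d)⁻¹ * ‖v k‖ ^ 2 * 2) := by gcongr
      _ = _ := by field_simp
  rw [sum_trial]
  have h1 := Finset.sum_le_sum fun k (_ : k ∈ Finset.univ) => hT k
  have h2 := Finset.sum_le_sum fun k (_ : k ∈ Finset.univ) => hF k
  rw [← Finset.sum_mul, ← EuclideanSpace.norm_sq_eq, hv] at h2
  simp only [Finset.sum_const, Finset.card_univ, Fintype.card_fin, nsmul_eq_mul] at h1
  rw [mul_inv_cancel_left₀ hd.ne'] at h1
  linarith

/-! ### Deviations of independent trials -/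

/-- The deviation of the operator computed from one trial from its mean. -/
def trialNoise {d : ℕ} (v : EuclideanSpace ℂ (Fin d)) (ω : TrialSeed d × Fin d) :
    EuclideanSpace ℂ (Fin d) →L[ℂ] EuclideanSpace ℂ (Fin d) :=
  sampleOp ω - InnerProductSpace.rankOne ℂ v v

lemma inner_trialNoise {d : ℕ} (v x y : EuclideanSpace ℂ (Fin d)) (ω : TrialSeed d × Fin d) :
    inner ℂ x (trialNoise v ω y) = inner ℂ x (sampleOp ω y) - inner ℂ x v * inner ℂ v y := by
  simp [trialNoise, mul_comm]

lemma sum_trialProb_mul_exp_re_le {d : ℕ} [NeZero d] (v x y : EuclideanSpace ℂ (Fin d)) (a : ℝ)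
    (hv : ‖v‖ = 1) (hx : ‖x‖ ≤ a) (ha : a ≤ 1 / 24) (hy : ‖y‖ ≤ 1) :
    ∑ ω, trialProb v ω * Real.exp (inner ℂ x (trialNoise v ω y)).re ≤
      Real.exp (21000 * a ^ 2) := by
  have ha0 : 0 ≤ a := (norm_nonneg x).trans hx
  obtain ⟨x', hx', rfl⟩ : ∃ x' : EuclideanSpace ℂ (Fin d), ‖x'‖ ≤ 1 ∧ x = (a : ℂ) • x' := by
    rcases ha0.eq_or_lt with rfl | hpos
    · exact ⟨0, by simp, by simpa using hx⟩
    · refine ⟨((a⁻¹ : ℝ) : ℂ) • x, ?_, ?_⟩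
      · rw [norm_smul, Complex.norm_real, Real.norm_of_nonneg (by positivity)]
        rwa [inv_mul_le_iff₀ hpos, mul_one]
      · rw [smul_smul, ← Complex.ofReal_mul, mul_inv_cancel₀ hpos.ne']; simp
  set X : TrialSeed d × Fin d → ℝ := fun ω => (inner ℂ x' (trialNoise v ω y)).re with hX
  have hmean : ∑ ω, trialProb v ω * X ω = 0 := by
    have h : ∑ ω, (trialProb v ω : ℂ) * inner ℂ x' (trialNoise v ω y) = 0 := by
      simp only [inner_trialNoise, mul_sub, Finset.sum_sub_distrib, sum_trialProb_mul_inner v x' y hv]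
      rw [← Finset.sum_mul, ← Complex.ofReal_sum, sum_trialProb v hv]
      simp
    have h2 := congrArg Complex.re h
    rw [Complex.re_sum] at h2
    simpa only [Complex.re_ofReal_mul, Complex.zero_re] using h2
  have he : Real.exp (1 / 12) ≤ 12 / 11 := by
    have h1 := Real.one_sub_le_exp_neg (1 / 12)
    have h2 : Real.exp (1 / 12) * Real.exp (-(1 / 12)) = 1 := by rw [← Real.exp_add]; simp
    nlinarith [Real.exp_pos (1 / 12)]
  have hK : ∑ ω, trialProb v ω * Real.exp (1 / 12 * |X ω|) ≤ 18 := by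
    calc _ ≤ ∑ ω, Real.exp (1 / 12) *
          (trialProb v ω * Real.exp (1 / 12 * ‖inner ℂ x' (sampleOp ω y)‖)) := by
          refine Finset.sum_le_sum fun ω _ => ?_
          rw [mul_left_comm, ← Real.exp_add]
          refine mul_le_mul_of_nonneg_left (Real.exp_le_exp.2 ?_) (trialProb_nonneg v ω)
          have h1 : |X ω| ≤ ‖inner ℂ x' (sampleOp ω y)‖ + 1 := by
            refine (Complex.abs_re_le_norm _).trans ?_
            rw [inner_trialNoise]
            refine (norm_sub_le _ _).trans (add_le_add le_rfl ?_)
            rw [norm_mul]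
            refine mul_le_one₀ ((norm_inner_le_norm _ _).trans ?_) (norm_nonneg _)
              ((norm_inner_le_norm _ _).trans ?_)
            · rw [hv, mul_one]; exact hx'
            · rw [hv, one_mul]; exact hy
          linarith
      _ = Real.exp (1 / 12) *
          ∑ ω, trialProb v ω * Real.exp (1 / 12 * ‖inner ℂ x' (sampleOp ω y)‖) := by
          rw [Finset.mul_sum]
      _ ≤ 12 / 11 * 16 := by
          refine mul_le_mul he (sum_trialProb_mul_exp_le v x' y hv hx' hy) ?_ (by norm_num)
          exact Finset.sum_nonneg fun ω _ =>
            mul_nonneg (trialProb_nonneg v ω) (Real.exp_pos _).le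
      _ ≤ 18 := by norm_num
  -- With `c = 1 / 12` and `K = 18` the coefficient is `8 * 144 * 18 = 20736`, rounded up to 21000.
  have h := sum_exp_le_of_exp_moment (trialProb v) X (trialProb_nonneg v) (sum_trialProb v hv)
    hmean (1 / 12) 18 a (by norm_num) hK ha0 (by linarith)
  have e : ∀ ω, (inner ℂ ((a : ℂ) • x') (trialNoise v ω y)).re = a * X ω := by
    intro ω
    rw [inner_smul_left, Complex.conj_ofReal, Complex.re_ofReal_mul]
  simp only [e]
  refine h.trans (Real.exp_le_exp.2 ?_)
  nlinarith [sq_nonneg a]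

/-- Independent trials: the exponential moment of a sum of deviations. -/
lemma sum_prod_trialProb_mul_exp_le {d : ℕ} [NeZero d] {ι : Type*} [Fintype ι] [DecidableEq ι]
    (v x y : ι → EuclideanSpace ℂ (Fin d)) (a : ι → ℝ) (hv : ∀ i, ‖v i‖ = 1)
    (hx : ∀ i, ‖x i‖ ≤ a i) (ha : ∀ i, a i ≤ 1 / 24) (hy : ∀ i, ‖y i‖ ≤ 1) :
    ∑ ω : ι → TrialSeed d × Fin d, (∏ i, trialProb (v i) (ω i)) *
        Real.exp (∑ i, (inner ℂ (x i) (trialNoise (v i) (ω i) (y i))).re) ≤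
      Real.exp (21000 * ∑ i, a i ^ 2) := by
  simp only [Real.exp_sum, ← Finset.prod_mul_distrib, Finset.mul_sum]
  rw [← Fintype.piFinset_univ, Finset.sum_prod_piFinset Finset.univ
    (fun i ω => trialProb (v i) ω * Real.exp (inner ℂ (x i) (trialNoise (v i) ω (y i))).re)]
  exact Finset.prod_le_prod
    (fun i _ => Finset.sum_nonneg fun ω _ =>
      mul_nonneg (trialProb_nonneg _ ω) (Real.exp_pos _).le)
    fun i _ => sum_trialProb_mul_exp_re_le (v i) (x i) (y i) (a i) (hv i) (hx i) (ha i) (hy i)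

lemma sum_prod_trialProb {d : ℕ} [NeZero d] {ι : Type*} [Fintype ι] [DecidableEq ι]
    (v : ι → EuclideanSpace ℂ (Fin d)) (hv : ∀ i, ‖v i‖ = 1) :
    ∑ ω : ι → TrialSeed d × Fin d, ∏ i, trialProb (v i) (ω i) = 1 := by
  rw [← Fintype.piFinset_univ, Finset.sum_prod_piFinset Finset.univ fun i ω => trialProb (v i) ω]
  simp [sum_trialProb _ (hv _)]

/-! ### Running the trials on a single register -/

lemma exists_unitary_mulVec_single {d : ℕ} (i : Fin d) (p : EuclideanSpace ℂ (Fin d))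
    (hp : ‖p‖ = 1) :
    ∃ U : UU d, (U : Matrix (Fin d) (Fin d) ℂ).mulVec (Pi.single i 1) = p := by
  have horth : Orthonormal ℂ (({i} : Set (Fin d)).domRestrict fun _ => p) := by
    rw [orthonormal_iff_ite]
    rintro ⟨j, hj⟩ ⟨k, hk⟩
    obtain rfl : j = i := hj
    obtain rfl : k = j := hk
    simp [inner_self_eq_norm_sq_to_K, hp]
  obtain ⟨b, hb⟩ := horth.exists_orthonormalBasis_extension_of_card_eq
    (by simp : Module.finrank ℂ (EuclideanSpace ℂ (Fin d)) = Fintype.card (Fin d))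
  refine ⟨⟨(EuclideanSpace.basisFun (Fin d) ℂ).toBasis.toMatrix b,
    (EuclideanSpace.basisFun (Fin d) ℂ).toMatrix_orthonormalBasis_mem_unitary b⟩, ?_⟩
  rw [Matrix.mulVec_single_one]
  ext k
  simp [Module.Basis.toMatrix_apply, hb i rfl]

/-- A unitary that takes the basis state `i` to the unit vector `p`. -/
def prepUnitary {d : ℕ} (i : Fin d) (p : EuclideanSpace ℂ (Fin d)) : UU d :=
  open Classical in
  if h : ∃ U : UU d, (U : Matrix (Fin d) (Fin d) ℂ).mulVec (Pi.single i 1) = p then h.choose else 1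

lemma prepUnitary_mulVec {d : ℕ} (i : Fin d) (p : EuclideanSpace ℂ (Fin d)) (hp : ‖p‖ = 1) :
    (prepUnitary i p : Matrix (Fin d) (Fin d) ℂ).mulVec (Pi.single i 1) = p := by
  have h := exists_unitary_mulVec_single i p hp
  rw [prepUnitary, dif_pos h]
  exact h.choose_spec

/-- The protocol that performs one trial on each of the states `Z p₀, Z p₁, …`, with the register
initially in the basis state `i`, and decodes the outcomes by `dec`. -/
def trialsProtocol {d : ℕ} [NeZero d] : (T : ℕ) → (Fin T → EuclideanSpace ℂ (Fin d)) →
    (Fin T → TrialSeed d) → Fin d → ((Fin T → Fin d) → UU d) → Protocol d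
  | 0, _, _, _, dec => .output (dec Fin.elim0)
  | T + 1, p, s, i, dec =>
    .applyUnitary (prepUnitary i (p 0)) <| .query <| .applyUnitary (measUnitary (s 0)) <|
      .measure fun k => trialsProtocol T (Fin.tail p) (Fin.tail s) k fun o => dec (Fin.cons k o)

lemma queries_trialsProtocol_le {d : ℕ} [NeZero d] (T : ℕ) (p : Fin T → EuclideanSpace ℂ (Fin d))
    (s : Fin T → TrialSeed d) (i : Fin d) (dec : (Fin T → Fin d) → UU d) :
    (trialsProtocol T p s i dec).queries ≤ T := by
  induction T generalizing i with
  | zero => simp [trialsProtocol, Protocol.queries]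
  | succ T ih =>
    simp only [trialsProtocol, Protocol.queries]
    exact Nat.succ_le_succ (Finset.sup_le fun k _ => ih _ _ _ _)

/-- Each measurement leaves a known basis state, from which the next probe is prepared exactly. Thus
no trial is disturbed by earlier ones and the outcome probabilities multiply. -/
lemma law_trialsProtocol {d : ℕ} [NeZero d] (Z : UU d) (S : Set (UU d)) (hS : MeasurableSet S)
    (T : ℕ) (p : Fin T → EuclideanSpace ℂ (Fin d)) (hp : ∀ t, ‖p t‖ = 1)
    (s : Fin T → TrialSeed d) (i : Fin d) (dec : (Fin T → Fin d) → UU d) :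
    (trialsProtocol T p s i dec).law Z (Pi.single i 1) S =
      ∑ o : Fin T → Fin d, (∏ t, ENNReal.ofReal (‖(measMatrix (s t)).mulVec
        ((Z : Matrix (Fin d) (Fin d) ℂ).mulVec (p t)) (o t)‖ ^ 2)) * S.indicator 1 (dec o) := by
  induction T generalizing i with
  | zero =>
    simp [trialsProtocol, Protocol.law, Measure.dirac_apply' _ hS, Subsingleton.elim _ Fin.elim0]
  | succ T ih =>
    simp only [trialsProtocol, Protocol.law, Measure.coe_finsetSum, Finset.sum_apply,
      Measure.smul_apply, smul_eq_mul]
    rw [← (Fin.consEquiv fun _ : Fin (T + 1) => Fin d).sum_comp, Fintype.sum_prod_type]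
    refine Finset.sum_congr rfl fun k _ => ?_
    rw [ih (Fin.tail p) (fun t => hp _), Finset.mul_sum, prepUnitary_mulVec _ _ (hp 0)]
    refine Finset.sum_congr rfl fun o _ => ?_
    rw [← mul_assoc, Fin.prod_univ_succ]
    rfl

/-- Nonadaptive trials on the states `Z (p i)`, followed by an arbitrary decoder, can be carried out
by a tomography algorithm. -/
lemma exists_trials_algorithm {d : ℕ} [NeZero d] {ι : Type} [Fintype ι] [DecidableEq ι]
    (p : ι → EuclideanSpace ℂ (Fin d)) (hp : ∀ i, ‖p i‖ = 1)
    (dec : (ι → TrialSeed d × Fin d) → UU d) :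
    ∃ A : TomographyAlgorithm d, A.QueriesAtMost (Fintype.card ι) ∧
      ∀ (Z : UU d) (S : Set (UU d)), MeasurableSet S →
        A.outputLaw Z S = ENNReal.ofReal (∑ ω : ι → TrialSeed d × Fin d,
          (∏ i, trialProb (Matrix.toEuclideanCLM (𝕜 := ℂ) (Z : Matrix (Fin d) (Fin d) ℂ) (p i))
            (ω i)) * S.indicator 1 (dec ω)) := by
  set T := Fintype.card ι with hT
  let e : ι ≃ Fin T := Fintype.equivFin ι
  let Seed : Type := Fin T → TrialSeed d
  let _ : MeasurableSpace Seed := ⊤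
  let prot : Seed → Protocol d := fun s =>
    trialsProtocol T (p ∘ e.symm) s 0 fun o => dec fun i => (s (e i), o (e i))
  let μ : Measure Seed := ∑ s : Seed, ((Fintype.card Seed : ENNReal))⁻¹ • Measure.dirac s
  have : IsProbabilityMeasure μ := ⟨by
    simp only [μ, Measure.coe_finsetSum, Finset.sum_apply, Measure.smul_apply, smul_eq_mul,
      measure_univ, mul_one, Finset.sum_const, Finset.card_univ, nsmul_eq_mul]
    exact ENNReal.mul_inv_cancel (by simp) (by simp)⟩
  have hmeas : ∀ Z : UU d, Measurable fun s => (prot s).law Z (Pi.single 0 1) :=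
    fun Z => measurable_from_top
  refine ⟨{ Seed := Seed, seedLaw := μ, protocol := prot, measurable_law := hmeas }, ?_, ?_⟩
  · intro s
    exact_mod_cast queries_trialsProtocol_le _ _ _ _ _
  intro Z S hS
  rw [TomographyAlgorithm.outputLaw, Measure.bind_apply hS (hmeas Z).aemeasurable]
  simp only [μ, lintegral_finsetSum_measure, lintegral_smul_measure, smul_eq_mul]
  have hpt : ∀ s : Seed, ∫⁻ a, (prot a).law Z (Pi.single 0 1) S ∂(Measure.dirac s) =
      (prot s).law Z (Pi.single 0 1) S := fun s => lintegral_dirac' _ measurable_from_top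
  have hlaw : ∀ s : Seed, ((Fintype.card Seed : ENNReal))⁻¹ * (prot s).law Z (Pi.single 0 1) S =
      ∑ o : Fin T → Fin d, ENNReal.ofReal ((∏ t, trialProb (Matrix.toEuclideanCLM (𝕜 := ℂ)
        (Z : Matrix (Fin d) (Fin d) ℂ) (p (e.symm t))) (s t, o t)) *
          S.indicator 1 (dec fun i => (s (e i), o (e i)))) := by
    intro s
    rw [show (prot s).law Z (Pi.single 0 1) S = _ from
      law_trialsProtocol Z S hS T (p ∘ e.symm) (fun t => hp _) s 0 _, Finset.mul_sum]
    refine Finset.sum_congr rfl fun o _ => ?_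
    -- The uniform mass of a seed splits into one factor per trial, which completes each Born
    -- probability to `trialProb`.
    have hcard : ((Fintype.card Seed : ENNReal))⁻¹ =
        ENNReal.ofReal (∏ _t : Fin T, ((2 * 4 ^ d : ℝ))⁻¹) := by
      rw [Finset.prod_const, ENNReal.ofReal_pow (by positivity),
        ENNReal.ofReal_inv_of_pos (by positivity), ← ENNReal.inv_pow]
      congr 1
      simp only [Seed, Fintype.card_fun, Fintype.card_prod, Fintype.card_bool, Fintype.card_fin,
        Finset.card_univ]
      push_cast
      rw [ENNReal.ofReal_mul (by norm_num), ENNReal.ofReal_pow (by norm_num)]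
      norm_num
    have hind : S.indicator (1 : UU d → ENNReal) (dec fun i => (s (e i), o (e i))) =
        ENNReal.ofReal (S.indicator 1 (dec fun i => (s (e i), o (e i)))) := by
      by_cases h : (dec fun i => (s (e i), o (e i))) ∈ S <;> simp [h]
    rw [hcard, ← ENNReal.ofReal_prod_of_nonneg (fun _ _ => by positivity), ← mul_assoc,
      ← ENNReal.ofReal_mul (by positivity), hind, ← ENNReal.ofReal_mul (by positivity),
      ← Finset.prod_mul_distrib]
    rfl
  simp only [hpt, hlaw]
  have hnn : ∀ ω : ι → TrialSeed d × Fin d, 0 ≤ (∏ i, trialProb (Matrix.toEuclideanCLM (𝕜 := ℂ)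
      (Z : Matrix (Fin d) (Fin d) ℂ) (p i)) (ω i)) * S.indicator (1 : UU d → ℝ) (dec ω) :=
    fun ω => mul_nonneg (Finset.prod_nonneg fun i _ => trialProb_nonneg _ _)
      (Set.indicator_nonneg (fun _ _ => zero_le_one) _)
  rw [ENNReal.ofReal_sum_of_nonneg fun ω _ => hnn ω, ← Fintype.sum_prod_type',
    ← (((Equiv.arrowProdEquivProdArrow (Fin T) (fun _ => TrialSeed d) (fun _ => Fin d)).symm.trans
      (e.arrowCongr (Equiv.refl (TrialSeed d × Fin d))).symm)).sum_comp]
  refine Finset.sum_congr rfl fun so _ => ?_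
  congr 2
  rw [← e.prod_comp]
  simp

/-- An infimum of continuous functions is upper semicontinuous, hence Borel. -/
lemma measurableSet_phaseDist_le {d : ℕ} (Z : UU d) (ε : ℝ) :
    MeasurableSet {V : UU d | phaseDist Z V ≤ ε} := by
  have hus : UpperSemicontinuous fun V : UU d => phaseDist Z V := by
    refine upperSemicontinuous_ciInf (fun V => ⟨0, ?_⟩) fun φ => ?_
    · rintro _ ⟨φ, rfl⟩
      exact norm_nonneg _
    · refine Continuous.upperSemicontinuous ?_
      have h : Continuous fun A : Matrix (Fin d) (Fin d) ℂ =>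
          Matrix.toEuclideanCLM (n := Fin d) (𝕜 := ℂ) A :=
        LinearMap.continuous_of_finiteDimensional
          (Matrix.toEuclideanCLM (n := Fin d) (𝕜 := ℂ)).toAlgEquiv.toLinearMap
      exact (h.comp (continuous_const.sub continuous_subtype_val)).norm
  exact hus.measurable measurableSet_Iic

/-! ### The estimator and its deterministic error analysis -/

open InnerProductSpace (rankOne)

/-- The operator on `ℂ^d` with columns `f 0, f 1, …`. -/
def columnsOp {d : ℕ} (f : Fin d → EuclideanSpace ℂ (Fin d)) :
    EuclideanSpace ℂ (Fin d) →L[ℂ] EuclideanSpace ℂ (Fin d) :=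
  ∑ j, rankOne ℂ (f j) (EuclideanSpace.single j (1 : ℂ))

lemma columnsOp_apply {d : ℕ} (f : Fin d → EuclideanSpace ℂ (Fin d))
    (y : EuclideanSpace ℂ (Fin d)) : columnsOp f y = ∑ j, y j • f j := by
  simp [columnsOp, EuclideanSpace.inner_single_left]

lemma columnsOp_add {d : ℕ} (f g : Fin d → EuclideanSpace ℂ (Fin d)) :
    columnsOp (f + g) = columnsOp f + columnsOp g := by
  ext1 y
  simp [columnsOp_apply, Finset.sum_add_distrib]

lemma eq_columnsOp {d : ℕ} (A : EuclideanSpace ℂ (Fin d) →L[ℂ] EuclideanSpace ℂ (Fin d)) :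
    A = columnsOp fun j => A (EuclideanSpace.single j 1) := by
  ext1 y
  rw [columnsOp_apply]
  conv_lhs => rw [← (EuclideanSpace.basisFun (Fin d) ℂ).sum_repr y]
  simp

/-- Cauchy-Schwarz. The loss of `√d` is acceptable because the bound is applied only to the bias. -/
lemma norm_columnsOp_le {d : ℕ} (f : Fin d → EuclideanSpace ℂ (Fin d)) (D : ℝ) (hD : 0 ≤ D)
    (hf : ∀ j, ‖f j‖ ≤ D) : ‖columnsOp f‖ ≤ D * Real.sqrt d := by
  refine ContinuousLinearMap.opNorm_le_bound _ (by positivity) fun y => ?_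
  rw [columnsOp_apply]
  have h1 : ‖∑ j, y j • f j‖ ≤ D * ∑ j, ‖y j‖ := by
    rw [Finset.mul_sum]
    refine (norm_sum_le _ _).trans (Finset.sum_le_sum fun j _ => ?_)
    rw [norm_smul, mul_comm]
    exact mul_le_mul_of_nonneg_right (hf j) (norm_nonneg _)
  have h2 : ∑ j, ‖y j‖ ≤ Real.sqrt d * ‖y‖ := by
    have h := sq_sum_le_card_mul_sum_sq (s := Finset.univ) (f := fun j => ‖y j‖)
    rw [← EuclideanSpace.norm_sq_eq, Finset.card_univ, Fintype.card_fin] at h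
    refine abs_le_of_sq_le_sq' ?_ (by positivity) |>.2
    rw [mul_pow, Real.sq_sqrt (Nat.cast_nonneg d)]
    exact h
  calc _ ≤ D * ∑ j, ‖y j‖ := h1
    _ ≤ D * (Real.sqrt d * ‖y‖) := by gcongr
    _ = _ := by ring

/-- Applying the difference of projections to `r` shows that `r` is within `δ` of `g • z`, with `g`
the overlap; then `‖g‖ ≥ 1 - δ`, so replacing `g` by its phase costs another `δ`. -/
lemma exists_phase_norm_sub_le {E : Type*} [NormedAddCommGroup E] [InnerProductSpace ℂ E]
    (r z : E) (hr : ‖r‖ = 1) (hz : ‖z‖ = 1) (δ : ℝ)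
    (h : ‖rankOne ℂ r r - rankOne ℂ z z‖ ≤ δ) : ∃ c : ℂ, ‖c‖ = 1 ∧ ‖r - c • z‖ ≤ 2 * δ := by
  set g : ℂ := inner ℂ z r with hg
  have h1 : ‖r - g • z‖ ≤ δ := by
    have := (rankOne ℂ r r - rankOne ℂ z z).le_opNorm r
    simp only [sub_apply, InnerProductSpace.rankOne_apply, hr, mul_one] at this
    rw [inner_self_eq_norm_sq_to_K, hr] at this
    simp only [Complex.coe_algebraMap, Complex.ofReal_one, one_pow, one_smul] at this
    exact this.trans h
  have hg1 : ‖g‖ ≤ 1 := by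
    have := norm_inner_le_norm (𝕜 := ℂ) z r
    rwa [hr, hz, one_mul] at this
  have hg2 : 1 - δ ≤ ‖g‖ := by
    have := norm_sub_norm_le r (g • z)
    rw [norm_smul, hr, hz, mul_one] at this
    linarith
  rcases eq_or_ne g 0 with h0 | h0
  -- Zero overlap forces `1 ≤ δ`, so the trivial bound 2 suffices.
  · refine ⟨1, by simp, ?_⟩
    rw [h0, norm_zero] at hg2
    have := norm_sub_le r z
    rw [one_smul]
    linarith
  · have hgn : 0 < ‖g‖ := norm_pos_iff.2 h0
    refine ⟨g / (‖g‖ : ℂ), by simp [hgn.ne'], ?_⟩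
    have h2 : ‖g - g / (‖g‖ : ℂ)‖ = 1 - ‖g‖ := by
      have hc : (‖g‖ : ℂ) ≠ 0 := by exact_mod_cast hgn.ne'
      rw [show g - g / (‖g‖ : ℂ) = -((1 - ‖g‖ : ℝ) : ℂ) * (g / (‖g‖ : ℂ)) by
        push_cast; field_simp; ring]
      rw [norm_mul, norm_neg, Complex.norm_real, Real.norm_of_nonneg (by linarith)]
      simp [hgn.ne']
    calc ‖r - (g / (‖g‖ : ℂ)) • z‖ = ‖(r - g • z) + (g - g / (‖g‖ : ℂ)) • z‖ := by
          rw [sub_smul]; congr 1; abel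
      _ ≤ ‖r - g • z‖ + ‖(g - g / (‖g‖ : ℂ)) • z‖ := norm_add_le _ _
      _ ≤ 2 * δ := by rw [norm_smul, hz, h2]; linarith

/-- The average of the operators computed from `n` trials. -/
def meanOp {d n : ℕ} (ω : Fin n → TrialSeed d × Fin d) :
    EuclideanSpace ℂ (Fin d) →L[ℂ] EuclideanSpace ℂ (Fin d) :=
  (n : ℂ)⁻¹ • ∑ i, sampleOp (ω i)

/-- A unit vector whose projection is close to the operator `M`, if there is one. -/
def refVec {d : ℕ} [NeZero d] (M : EuclideanSpace ℂ (Fin d) →L[ℂ] EuclideanSpace ℂ (Fin d))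
    (δ : ℝ) : EuclideanSpace ℂ (Fin d) :=
  open Classical in
  if h : ∃ r : EuclideanSpace ℂ (Fin d), ‖r‖ = 1 ∧ ‖M - rankOne ℂ r r‖ ≤ δ then h.choose
  else EuclideanSpace.single 0 1

lemma norm_refVec {d : ℕ} [NeZero d]
    (M : EuclideanSpace ℂ (Fin d) →L[ℂ] EuclideanSpace ℂ (Fin d)) (δ : ℝ) :
    ‖refVec M δ‖ = 1 := by
  rw [refVec]
  split_ifs with h
  · exact h.choose_spec.1
  · simp

/-- The vector `z` itself shows that the choice in `refVec` succeeds, and both projections are then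
within `δ` of `M`. -/
lemma exists_phase_norm_refVec_sub_le {d : ℕ} [NeZero d]
    (M : EuclideanSpace ℂ (Fin d) →L[ℂ] EuclideanSpace ℂ (Fin d)) (δ : ℝ)
    (z : EuclideanSpace ℂ (Fin d)) (hz : ‖z‖ = 1) (h : ‖M - rankOne ℂ z z‖ ≤ δ) :
    ∃ c : ℂ, ‖c‖ = 1 ∧ ‖refVec M δ - c • z‖ ≤ 4 * δ := by
  have hex : ∃ r : EuclideanSpace ℂ (Fin d), ‖r‖ = 1 ∧ ‖M - rankOne ℂ r r‖ ≤ δ := ⟨z, hz, h⟩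
  have hr : ‖M - rankOne ℂ (refVec M δ) (refVec M δ)‖ ≤ δ := by
    rw [refVec, dif_pos hex]
    exact hex.choose_spec.2
  obtain ⟨c, hc, h2⟩ := exists_phase_norm_sub_le (refVec M δ) z (norm_refVec M δ) hz (2 * δ) (by
    rw [show rankOne ℂ (refVec M δ) (refVec M δ) - rankOne ℂ z z =
      (M - rankOne ℂ z z) - (M - rankOne ℂ (refVec M δ) (refVec M δ)) by abel]
    refine (norm_sub_le _ _).trans ?_
    linarith)
  exact ⟨c, hc, by linarith⟩

/-- The state in superposition of the basis states `0` and `j`. -/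
def probe {d : ℕ} [NeZero d] (j : Fin d) : EuclideanSpace ℂ (Fin d) :=
  if j = 0 then EuclideanSpace.single 0 1
  else ((Real.sqrt 2)⁻¹ : ℂ) • (EuclideanSpace.single 0 1 + EuclideanSpace.single j 1)

/-- The reciprocal of the weight of the basis state `j` in `probe j`. -/
def probeScale {d : ℕ} [NeZero d] (j : Fin d) : ℂ := if j = 0 then 1 else 2

lemma norm_probeScale_le {d : ℕ} [NeZero d] (j : Fin d) : ‖probeScale j‖ ≤ 2 := by
  rw [probeScale]; split_ifs <;> simp

lemma norm_probe {d : ℕ} [NeZero d] (j : Fin d) : ‖probe j‖ = 1 := by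
  rw [probe]
  split_ifs with h
  · simp
  · have h2 : ‖EuclideanSpace.single 0 (1 : ℂ) + EuclideanSpace.single j (1 : ℂ)‖ ^ 2 = 2 := by
      rw [sq, norm_add_sq_eq_norm_sq_add_norm_sq_of_inner_eq_zero (𝕜 := ℂ)]
      · simp; norm_num
      · simp [EuclideanSpace.inner_single_left, Ne.symm h]
    have h3 : ‖EuclideanSpace.single 0 (1 : ℂ) + EuclideanSpace.single j (1 : ℂ)‖ =
        Real.sqrt 2 := by
      rw [← h2, Real.sqrt_sq (norm_nonneg _)]
    rw [norm_smul, h3, norm_inv, Complex.norm_real, Real.norm_of_nonneg (Real.sqrt_nonneg 2),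
      inv_mul_cancel₀ (by positivity)]

/-- The estimate of the unknown unitary, up to a phase, from trials on the states `Z (probe j)` and
a unit vector `r` close to the image of the basis state `0`. -/
def estimateOp {d n : ℕ} [NeZero d] (r : EuclideanSpace ℂ (Fin d))
    (ω : Fin d × Fin n → TrialSeed d × Fin d) :
    EuclideanSpace ℂ (Fin d) →L[ℂ] EuclideanSpace ℂ (Fin d) :=
  columnsOp fun j => probeScale j • meanOp (fun i => ω (j, i)) r - (probeScale j - 1) • r

/-- The deviation of `estimateOp` from its mean. -/
def estimateNoise {d n : ℕ} [NeZero d] (Z : UU d) (r : EuclideanSpace ℂ (Fin d))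
    (ω : Fin d × Fin n → TrialSeed d × Fin d) :
    EuclideanSpace ℂ (Fin d) →L[ℂ] EuclideanSpace ℂ (Fin d) :=
  columnsOp fun j => probeScale j • (meanOp (fun i => ω (j, i)) -
    rankOne ℂ (Matrix.toEuclideanCLM (𝕜 := ℂ) (Z : Matrix (Fin d) (Fin d) ℂ) (probe j))
      (Matrix.toEuclideanCLM (𝕜 := ℂ) (Z : Matrix (Fin d) (Fin d) ℂ) (probe j))) r

/-- The mean of a column of `estimateOp` is close to the column of the unknown unitary, up to a
phase common to all columns. -/
lemma norm_column_sub_le {d : ℕ} [NeZero d] (Z : UU d) (r : EuclideanSpace ℂ (Fin d)) (c : ℂ)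
    (δ : ℝ) (h : ‖r - c • Matrix.toEuclideanCLM (𝕜 := ℂ) (Z : Matrix (Fin d) (Fin d) ℂ)
      (EuclideanSpace.single 0 1)‖ ≤ δ) (j : Fin d) :
    ‖probeScale j • rankOne ℂ
        (Matrix.toEuclideanCLM (𝕜 := ℂ) (Z : Matrix (Fin d) (Fin d) ℂ) (probe j))
        (Matrix.toEuclideanCLM (𝕜 := ℂ) (Z : Matrix (Fin d) (Fin d) ℂ) (probe j)) r -
      (probeScale j - 1) • r -
      c • Matrix.toEuclideanCLM (𝕜 := ℂ) (Z : Matrix (Fin d) (Fin d) ℂ)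
        (EuclideanSpace.single j 1)‖ ≤ 5 * δ := by
  have hin := inner_toEuclideanCLM_apply Z
  have hno := norm_toEuclideanCLM_apply Z
  set T := Matrix.toEuclideanCLM (n := Fin d) (𝕜 := ℂ) (Z : Matrix (Fin d) (Fin d) ℂ)
  set z : Fin d → EuclideanSpace ℂ (Fin d) := fun j => T (EuclideanSpace.single j 1) with hz
  have hzn : ∀ j, ‖z j‖ = 1 := fun j => by simp [hz, hno]
  have hδ : 0 ≤ δ := (norm_nonneg _).trans h
  set q := r - c • z 0 with hq
  have hr : r = c • z 0 + q := by rw [hq]; abel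
  have hb : ∀ j, ‖inner ℂ (z j) q‖ ≤ δ := fun j =>
    (norm_inner_le_norm _ _).trans (by rw [hzn, one_mul]; exact h)
  have h0 : inner ℂ (z 0) r = c + inner ℂ (z 0) q := by
    rw [hq, inner_sub_right, inner_smul_right, inner_self_eq_norm_sq_to_K, hzn]; simp
  by_cases hj : j = 0
  · subst hj
    have e : probeScale (0 : Fin d) • rankOne ℂ (T (probe 0)) (T (probe 0)) r -
        (probeScale (0 : Fin d) - 1) • r - c • T (EuclideanSpace.single 0 1) =
        inner ℂ (z 0) q • z 0 := by
      simp only [probeScale, probe, if_true, InnerProductSpace.rankOne_apply, one_smul, sub_self,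
        zero_smul, sub_zero]
      change inner ℂ (z 0) r • z 0 - c • z 0 = _
      rw [h0, add_smul]; abel
    rw [e, norm_smul, hzn, mul_one]
    linarith [hb 0]
  · have hj0 : inner ℂ (z j) r = inner ℂ (z j) q := by
      have : inner ℂ (z j) (z 0) = (0 : ℂ) := by
        simp only [hz, hin]
        simp [EuclideanSpace.inner_single_left, hj]
      rw [hr, inner_add_right, inner_smul_right, this]; simp
    have hs : (starRingEnd ℂ) ((Real.sqrt 2 : ℂ)⁻¹) * ((Real.sqrt 2 : ℂ)⁻¹) * 2 = 1 := by
      rw [map_inv₀, Complex.conj_ofReal, ← mul_inv, ← Complex.ofReal_mul,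
        Real.mul_self_sqrt (by norm_num)]
      norm_num
    have e1 : (2 : ℂ) • rankOne ℂ (T (probe j)) (T (probe j)) r =
        (inner ℂ (z 0) r + inner ℂ (z j) r) • (z 0 + z j) := by
      have hp : T (probe j) = ((Real.sqrt 2)⁻¹ : ℂ) • (z 0 + z j) := by
        rw [probe, if_neg hj, map_smul, map_add]
      rw [InnerProductSpace.rankOne_apply, hp, inner_smul_left, inner_add_left, smul_smul,
        smul_smul]
      congr 1
      linear_combination (inner ℂ (z 0) r + inner ℂ (z j) r) * hs
    -- The main terms `c • z 0` and `c • z j` cancel. Five terms linear in `q` remain, each of norm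
    -- at most `δ`.
    have e : probeScale j • rankOne ℂ (T (probe j)) (T (probe j)) r -
        (probeScale j - 1) • r - c • T (EuclideanSpace.single j 1) =
        inner ℂ (z 0) q • z 0 + inner ℂ (z j) q • z 0 + inner ℂ (z 0) q • z j +
          inner ℂ (z j) q • z j - q := by
      rw [show probeScale j = 2 from if_neg hj, e1, h0, hj0, hq]
      change _ - _ - c • z j = _
      module
    rw [e]
    have hle : ∀ i k, ‖inner ℂ (z i) q • z k‖ ≤ δ := fun i k => by
      rw [norm_smul, hzn, mul_one]; exact hb i
    refine (norm_sub_le _ _).trans ?_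
    have h1 := norm_add₄_le (a := inner ℂ (z 0) q • z 0) (b := inner ℂ (z j) q • z 0)
      (c := inner ℂ (z 0) q • z j) (d := inner ℂ (z j) q • z j)
    linarith [hle 0 0, hle j 0, hle 0 j, hle j j]

/-- A unitary close to the operator `A`, if there is one. -/
def nearUnitary {d : ℕ} (A : EuclideanSpace ℂ (Fin d) →L[ℂ] EuclideanSpace ℂ (Fin d)) (τ : ℝ) :
    UU d :=
  open Classical in
  if h : ∃ V : UU d, ‖A - Matrix.toEuclideanCLM (𝕜 := ℂ) (V : Matrix (Fin d) (Fin d) ℂ)‖ ≤ τ then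
    h.choose else 1

/-- The unitary `c • Z` is itself a candidate, so the choice succeeds without knowledge of `Z` or
`c`. -/
lemma phaseDist_nearUnitary_le {d : ℕ} (Z : UU d) (c : ℂ) (hc : ‖c‖ = 1)
    (A : EuclideanSpace ℂ (Fin d) →L[ℂ] EuclideanSpace ℂ (Fin d)) (τ : ℝ)
    (h : ‖A - c • Matrix.toEuclideanCLM (𝕜 := ℂ) (Z : Matrix (Fin d) (Fin d) ℂ)‖ ≤ τ) :
    phaseDist Z (nearUnitary A τ) ≤ 2 * τ := by
  have hex : ∃ V : UU d,
      ‖A - Matrix.toEuclideanCLM (𝕜 := ℂ) (V : Matrix (Fin d) (Fin d) ℂ)‖ ≤ τ := by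
    refine ⟨⟨c • (Z : Matrix (Fin d) (Fin d) ℂ), ?_⟩, ?_⟩
    · rw [Matrix.mem_unitaryGroup_iff, star_smul, Matrix.smul_mul, Matrix.mul_smul, smul_smul,
        Matrix.mem_unitaryGroup_iff.1 Z.2, mul_comm, star_mul_self_of_norm_eq_one hc, one_smul]
    · rwa [map_smul]
  have hV : ‖A - Matrix.toEuclideanCLM (𝕜 := ℂ)
      (nearUnitary A τ : Matrix (Fin d) (Fin d) ℂ)‖ ≤ τ := by
    rw [nearUnitary, dif_pos hex]
    exact hex.choose_spec
  refine (ciInf_le ⟨0, ?_⟩ (⟨c, mem_sphere_zero_iff_norm.2 hc⟩ : Circle)).trans ?_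
  · rintro _ ⟨φ, rfl⟩
    exact norm_nonneg _
  · rw [opNorm, map_sub, map_smul]
    change ‖c • _ - _‖ ≤ _
    rw [show ∀ B C : EuclideanSpace ℂ (Fin d) →L[ℂ] EuclideanSpace ℂ (Fin d),
      B - C = (A - C) - (A - B) from fun B C => by abel]
    refine (norm_sub_le _ _).trans ?_
    linarith

/-- The output computed from the outcomes of all trials. -/
def decode {d m n : ℕ} [NeZero d] (δ τ : ℝ) (ω₁ : Fin m → TrialSeed d × Fin d)
    (ω₂ : Fin d × Fin n → TrialSeed d × Fin d) : UU d :=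
  nearUnitary (estimateOp (refVec (meanOp ω₁) δ) ω₂) τ

/-- The error is noise plus bias. A reference error of `4 * δ` gives bias columns of norm at most
`20 * δ`, so `hδτ` keeps the whole bias below `τ`; rounding to a unitary doubles the sum. -/
lemma phaseDist_decode_le {d m n : ℕ} [NeZero d] (Z : UU d) (δ τ : ℝ)
    (hδτ : 20 * δ * Real.sqrt d ≤ τ)
    (ω₁ : Fin m → TrialSeed d × Fin d) (ω₂ : Fin d × Fin n → TrialSeed d × Fin d)
    (h₁ : ‖meanOp ω₁ - rankOne ℂ
      (Matrix.toEuclideanCLM (𝕜 := ℂ) (Z : Matrix (Fin d) (Fin d) ℂ) (probe 0))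
      (Matrix.toEuclideanCLM (𝕜 := ℂ) (Z : Matrix (Fin d) (Fin d) ℂ) (probe 0))‖ ≤ δ)
    (h₂ : ‖estimateNoise Z (refVec (meanOp ω₁) δ) ω₂‖ ≤ τ) :
    phaseDist Z (decode δ (2 * τ) ω₁ ω₂) ≤ 4 * τ := by
  have hδ : 0 ≤ δ := (norm_nonneg _).trans h₁
  obtain ⟨c, hc, hr⟩ := exists_phase_norm_refVec_sub_le (meanOp ω₁) δ _
    (by rw [norm_toEuclideanCLM_apply, norm_probe]) h₁
  rw [show probe (0 : Fin d) = EuclideanSpace.single 0 1 from if_pos rfl] at hr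
  refine (phaseDist_nearUnitary_le Z c hc _ (2 * τ) ?_).trans (by linarith)
  set r := refVec (meanOp ω₁) δ
  set T := Matrix.toEuclideanCLM (n := Fin d) (𝕜 := ℂ) (Z : Matrix (Fin d) (Fin d) ℂ) with hT
  set f : Fin d → EuclideanSpace ℂ (Fin d) := fun j =>
    probeScale j • rankOne ℂ (T (probe j)) (T (probe j)) r - (probeScale j - 1) • r -
      c • T (EuclideanSpace.single j 1) with hf
  have e : estimateOp r ω₂ - c • T = estimateNoise Z r ω₂ + columnsOp f := by
    rw [sub_eq_iff_eq_add, eq_columnsOp (c • T), estimateOp, estimateNoise, ← columnsOp_add,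
      ← columnsOp_add]
    congr 1
    ext1 j
    simp only [Pi.add_apply, hf, sub_apply, smul_apply, ← hT]
    module
  rw [e]
  have hcol := norm_columnsOp_le f (5 * (4 * δ)) (by positivity)
    fun j => norm_column_sub_le Z r c (4 * δ) hr j
  refine (norm_add_le _ _).trans ?_
  linarith

/-! ### Failure probability of the estimator -/

lemma mul_inner_meanOp_sub {d n : ℕ} (hn : n ≠ 0) (v x y : EuclideanSpace ℂ (Fin d))
    (ω : Fin n → TrialSeed d × Fin d) :
    (n : ℂ) * inner ℂ x ((meanOp ω - rankOne ℂ v v) y) =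
      ∑ i, inner ℂ x (trialNoise v (ω i) y) := by
  have hn' : (n : ℂ) ≠ 0 := by exact_mod_cast hn
  simp only [inner_trialNoise, Finset.sum_sub_distrib, Finset.sum_const, Finset.card_univ,
    Fintype.card_fin, nsmul_eq_mul]
  rw [sub_apply, inner_sub_right, mul_sub, meanOp, smul_apply, inner_smul_right,
    mul_inv_cancel_left₀ hn', sum_apply, inner_sum, InnerProductSpace.rankOne_apply,
    inner_smul_right, mul_comm (inner ℂ v y)]

/-- Tomography of one state: the mean of the trials is close to the projection onto the state. -/
lemma sum_meanOp_tail_le {d n : ℕ} [NeZero d] (hn : n ≠ 0) (v : EuclideanSpace ℂ (Fin d))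
    (hv : ‖v‖ = 1) (τ : ℝ) (hτ0 : 0 ≤ τ) (hτ1 : τ ≤ 1) :
    ∑ ω : Fin n → TrialSeed d × Fin d, (∏ i, trialProb v (ω i)) *
      {ω : Fin n → TrialSeed d × Fin d | τ < ‖meanOp ω - rankOne ℂ v v‖}.indicator 1 ω ≤
      625 ^ d * Real.exp (-(n * τ ^ 2 / 5376000)) := by
  refine sum_opNorm_gt_le _ (fun ω => Finset.prod_nonneg fun i _ => trialProb_nonneg _ _)
    (fun ω => meanOp ω - rankOne ℂ v v) n τ (Nat.cast_nonneg n) hτ0 hτ1 ?_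
  intro μ hμ0 hμ1 x y hx hy
  have h := sum_prod_trialProb_mul_exp_le (ι := Fin n) (fun _ => v) (fun _ => (μ : ℂ) • x)
    (fun _ => y) (fun _ => μ) (fun _ => hv) (fun _ => by
      rw [norm_smul, Complex.norm_real, Real.norm_of_nonneg hμ0]
      exact mul_le_of_le_one_right hμ0 hx) (fun _ => by linarith) (fun _ => hy)
  have e : ∀ ω : Fin n → TrialSeed d × Fin d,
      ∑ i, (inner ℂ ((μ : ℂ) • x) (trialNoise v (ω i) y)).re =
      n * μ * (inner ℂ x ((meanOp ω - rankOne ℂ v v) y)).re := by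
    intro ω
    rw [← Complex.re_sum]
    simp only [inner_smul_left, Complex.conj_ofReal]
    rw [← Finset.mul_sum, ← mul_inner_meanOp_sub hn, Complex.re_ofReal_mul,
      ← Complex.ofReal_natCast, Complex.re_ofReal_mul]
    ring
  simp only [e] at h
  refine h.trans (Real.exp_le_exp.2 ?_)
  rw [Finset.sum_const, Finset.card_univ, Fintype.card_fin, nsmul_eq_mul]
  nlinarith [mul_nonneg (Nat.cast_nonneg (α := ℝ) n) (sq_nonneg μ)]

/-- The noise of the estimate of the unknown unitary is small in operator norm. -/
lemma sum_estimateNoise_tail_le {d n : ℕ} [NeZero d] (hn : n ≠ 0) (Z : UU d)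
    (r : EuclideanSpace ℂ (Fin d)) (hr : ‖r‖ = 1) (τ : ℝ) (hτ0 : 0 ≤ τ) (hτ1 : τ ≤ 1) :
    ∑ ω : Fin d × Fin n → TrialSeed d × Fin d,
      (∏ i, trialProb (Matrix.toEuclideanCLM (𝕜 := ℂ) (Z : Matrix (Fin d) (Fin d) ℂ)
        (probe i.1)) (ω i)) *
      {ω : Fin d × Fin n → TrialSeed d × Fin d | τ < ‖estimateNoise Z r ω‖}.indicator 1 ω ≤
      625 ^ d * Real.exp (-(n * τ ^ 2 / 5376000)) := by
  refine sum_opNorm_gt_le _ (fun ω => Finset.prod_nonneg fun i _ => trialProb_nonneg _ _)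
    (fun ω => estimateNoise Z r ω) n τ (Nat.cast_nonneg n) hτ0 hτ1 ?_
  intro μ hμ0 hμ1 x y hx hy
  have hno := norm_toEuclideanCLM_apply Z
  set T := Matrix.toEuclideanCLM (n := Fin d) (𝕜 := ℂ) (Z : Matrix (Fin d) (Fin d) ℂ) with hT
  have hyj : ∀ j, ‖y j‖ ≤ 1 := fun j => (PiLp.norm_apply_le y j).trans hy
  -- The coefficient of column `j` is moved into the left vector, so its trials carry weight `2 * μ
  -- * ‖y j‖`. The squares add up to `4 n μ² ‖y‖²` with no factor `d`; this is the source of `84000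
  -- = 4 * 21000` and of the range `μ ≤ 1 / 48`.
  have h := sum_prod_trialProb_mul_exp_le (ι := Fin d × Fin n) (fun i => T (probe i.1))
    (fun i => ((μ : ℂ) * star (y i.1 * probeScale i.1)) • x)
    (fun _ => r) (fun i => 2 * μ * ‖y i.1‖) (fun i => by rw [hno, norm_probe]) (fun i => by
      rw [norm_smul, norm_mul, Complex.norm_real, Real.norm_of_nonneg hμ0, norm_star, norm_mul]
      calc μ * (‖y i.1‖ * ‖probeScale i.1‖) * ‖x‖ ≤ μ * (‖y i.1‖ * 2) * 1 := by
            gcongr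
            exact norm_probeScale_le _
        _ = _ := by ring)
    (fun i => by nlinarith [hyj i.1, norm_nonneg (y i.1)]) (fun _ => hr.le)
  have e : ∀ ω : Fin d × Fin n → TrialSeed d × Fin d,
      ∑ i, (inner ℂ (((μ : ℂ) * star (y i.1 * probeScale i.1)) • x)
        (trialNoise (T (probe i.1)) (ω i) r)).re =
      n * μ * (inner ℂ x (estimateNoise Z r ω y)).re := by
    intro ω
    rw [← Complex.re_sum, Fintype.sum_prod_type]
    have hj : ∀ j, ∑ i : Fin n, inner ℂ (((μ : ℂ) * star (y j * probeScale j)) • x)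
        (trialNoise (T (probe j)) (ω (j, i)) r) = (n : ℂ) * μ * (y j * (probeScale j *
          inner ℂ x ((meanOp (fun i => ω (j, i)) - rankOne ℂ (T (probe j)) (T (probe j))) r))) := by
      intro j
      simp only [inner_smul_left, map_mul, Complex.conj_ofReal, Complex.star_def, Complex.conj_conj]
      rw [← Finset.mul_sum, ← mul_inner_meanOp_sub hn]
      ring
    simp only [hj]
    rw [← Finset.mul_sum, estimateNoise, columnsOp_apply, inner_sum]
    simp only [inner_smul_right, ← hT]
    rw [← Complex.ofReal_natCast, ← Complex.ofReal_mul, Complex.re_ofReal_mul]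
  simp only [e] at h
  refine h.trans (Real.exp_le_exp.2 ?_)
  have hsum : ∑ i : Fin d × Fin n, (2 * μ * ‖y i.1‖) ^ 2 = n * (4 * μ ^ 2) * ‖y‖ ^ 2 := by
    rw [Fintype.sum_prod_type, EuclideanSpace.norm_sq_eq, Finset.mul_sum]
    refine Finset.sum_congr rfl fun j _ => ?_
    dsimp only
    rw [Finset.sum_const, Finset.card_univ, Fintype.card_fin, nsmul_eq_mul]
    ring
  rw [hsum]
  have hy2 : ‖y‖ ^ 2 ≤ 1 := by nlinarith [norm_nonneg y]
  calc 21000 * (n * (4 * μ ^ 2) * ‖y‖ ^ 2) ≤ 21000 * (n * (4 * μ ^ 2) * 1) := by gcongr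
    _ = _ := by ring

/-- The failure probability of the decoder. -/
lemma sum_decode_failure_le {d m n : ℕ} [NeZero d] (hm : m ≠ 0) (hn : n ≠ 0) (Z : UU d)
    (δ τ : ℝ) (hδ0 : 0 ≤ δ) (hδ1 : δ ≤ 1) (hτ0 : 0 ≤ τ) (hτ1 : τ ≤ 1)
    (hδτ : 20 * δ * Real.sqrt d ≤ τ) :
    ∑ ω : Fin m ⊕ (Fin d × Fin n) → TrialSeed d × Fin d,
      (∏ i, trialProb (Matrix.toEuclideanCLM (𝕜 := ℂ) (Z : Matrix (Fin d) (Fin d) ℂ)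
        (Sum.elim (fun _ => probe 0) (fun j => probe j.1) i)) (ω i)) *
      {V : UU d | ¬ phaseDist Z V ≤ 4 * τ}.indicator 1
        (decode δ (2 * τ) (ω ∘ Sum.inl) (ω ∘ Sum.inr)) ≤
      625 ^ d * Real.exp (-(m * δ ^ 2 / 5376000)) +
        625 ^ d * Real.exp (-(n * τ ^ 2 / 5376000)) := by
  have hno := norm_toEuclideanCLM_apply Z
  have htail₁ := sum_meanOp_tail_le hm
    (Matrix.toEuclideanCLM (𝕜 := ℂ) (Z : Matrix (Fin d) (Fin d) ℂ) (probe 0))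
    (by rw [hno, norm_probe]) δ hδ0 hδ1
  have htail₂ := fun r hr => sum_estimateNoise_tail_le hn Z r hr τ hτ0 hτ1
  have hdec := fun ω₁ ω₂ => phaseDist_decode_le (m := m) (n := n) Z δ τ hδτ ω₁ ω₂
  set T := Matrix.toEuclideanCLM (n := Fin d) (𝕜 := ℂ) (Z : Matrix (Fin d) (Fin d) ℂ) with hT
  set p₁ : (Fin m → TrialSeed d × Fin d) → ℝ := fun ω => ∏ i, trialProb (T (probe 0)) (ω i)
    with hp₁
  set p₂ : (Fin d × Fin n → TrialSeed d × Fin d) → ℝ :=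
    fun ω => ∏ i, trialProb (T (probe i.1)) (ω i) with hp₂
  have hp₁0 : ∀ ω, 0 ≤ p₁ ω := fun ω => Finset.prod_nonneg fun i _ => trialProb_nonneg _ _
  have hp₂0 : ∀ ω, 0 ≤ p₂ ω := fun ω => Finset.prod_nonneg fun i _ => trialProb_nonneg _ _
  have hp₁1 : ∑ ω, p₁ ω = 1 :=
    sum_prod_trialProb (fun _ : Fin m => T (probe 0)) fun _ => by rw [hno, norm_probe]
  have hp₂1 : ∑ ω, p₂ ω = 1 :=
    sum_prod_trialProb (fun i : Fin d × Fin n => T (probe i.1)) fun _ => by rw [hno, norm_probe]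
  set B₁ : Set (Fin m → TrialSeed d × Fin d) :=
    {ω | δ < ‖meanOp ω - rankOne ℂ (T (probe 0)) (T (probe 0))‖} with hB₁
  -- This event depends on `ω₁` through the reference vector. The tail bound holds for every unit
  -- `r`, so it can be applied with `ω₁` fixed and then averaged.
  set B₂ : (Fin m → TrialSeed d × Fin d) → Set (Fin d × Fin n → TrialSeed d × Fin d) :=
    fun ω₁ => {ω | τ < ‖estimateNoise Z (refVec (meanOp ω₁) δ) ω‖} with hB₂
  rw [← (Equiv.sumArrowEquivProdArrow (Fin m) (Fin d × Fin n) (TrialSeed d × Fin d)).symm.sum_comp,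
    Fintype.sum_prod_type]
  have hpt : ∀ ω₁ ω₂, (∏ i, trialProb (T (Sum.elim (fun _ => probe 0) (fun j => probe j.1) i))
      ((Equiv.sumArrowEquivProdArrow (Fin m) (Fin d × Fin n) (TrialSeed d × Fin d)).symm
        (ω₁, ω₂) i)) *
      {V : UU d | ¬ phaseDist Z V ≤ 4 * τ}.indicator 1 (decode δ (2 * τ)
        ((Equiv.sumArrowEquivProdArrow (Fin m) (Fin d × Fin n) (TrialSeed d × Fin d)).symm
          (ω₁, ω₂) ∘ Sum.inl)
        ((Equiv.sumArrowEquivProdArrow (Fin m) (Fin d × Fin n) (TrialSeed d × Fin d)).symm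
          (ω₁, ω₂) ∘ Sum.inr)) ≤
      p₁ ω₁ * B₁.indicator 1 ω₁ * p₂ ω₂ + p₁ ω₁ * (p₂ ω₂ * (B₂ ω₁).indicator 1 ω₂) := by
    intro ω₁ ω₂
    rw [Fintype.prod_sum_type]
    change p₁ ω₁ * p₂ ω₂ * Set.indicator _ 1 (decode δ (2 * τ) ω₁ ω₂) ≤ _
    have hind : {V : UU d | ¬ phaseDist Z V ≤ 4 * τ}.indicator (1 : UU d → ℝ)
        (decode δ (2 * τ) ω₁ ω₂) ≤ B₁.indicator 1 ω₁ + (B₂ ω₁).indicator 1 ω₂ := by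
      have hn₁ : 0 ≤ B₁.indicator (1 : (Fin m → TrialSeed d × Fin d) → ℝ) ω₁ :=
        Set.indicator_nonneg (fun _ _ => zero_le_one) _
      have hn₂ : 0 ≤ (B₂ ω₁).indicator (1 : (Fin d × Fin n → TrialSeed d × Fin d) → ℝ) ω₂ :=
        Set.indicator_nonneg (fun _ _ => zero_le_one) _
      by_cases h : decode δ (2 * τ) ω₁ ω₂ ∈ {V : UU d | ¬ phaseDist Z V ≤ 4 * τ}
      · rw [Set.indicator_of_mem h]
        by_cases h₁ : ω₁ ∈ B₁
        · rw [Set.indicator_of_mem h₁]; simpa using hn₂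
        · by_cases h₂ : ω₂ ∈ B₂ ω₁
          · rw [Set.indicator_of_mem h₂]; simpa using hn₁
          · exact absurd (hdec ω₁ ω₂ (not_lt.1 h₁) (not_lt.1 h₂)) h
      · rw [Set.indicator_of_notMem h]; positivity
    calc _ ≤ p₁ ω₁ * p₂ ω₂ * (B₁.indicator 1 ω₁ + (B₂ ω₁).indicator 1 ω₂) :=
          mul_le_mul_of_nonneg_left hind (mul_nonneg (hp₁0 _) (hp₂0 _))
      _ = _ := by ring
  calc _ ≤ ∑ ω₁, ∑ ω₂, (p₁ ω₁ * B₁.indicator 1 ω₁ * p₂ ω₂ +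
        p₁ ω₁ * (p₂ ω₂ * (B₂ ω₁).indicator 1 ω₂)) :=
        Finset.sum_le_sum fun ω₁ _ => Finset.sum_le_sum fun ω₂ _ => hpt ω₁ ω₂
    _ = ∑ ω₁, p₁ ω₁ * B₁.indicator 1 ω₁ +
        ∑ ω₁, p₁ ω₁ * ∑ ω₂, p₂ ω₂ * (B₂ ω₁).indicator 1 ω₂ := by
      simp only [Finset.sum_add_distrib, ← Finset.mul_sum, hp₂1, mul_one]
    _ ≤ 625 ^ d * Real.exp (-(m * δ ^ 2 / 5376000)) +
        ∑ ω₁, p₁ ω₁ * (625 ^ d * Real.exp (-(n * τ ^ 2 / 5376000))) :=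
      add_le_add htail₁ (Finset.sum_le_sum fun ω₁ _ =>
        mul_le_mul_of_nonneg_left (htail₂ _ (norm_refVec _ _)) (hp₁0 ω₁))
    _ = _ := by rw [← Finset.sum_mul, hp₁1, one_mul]

/-! ### Choice of parameters -/

lemma phaseDist_le_two {d : ℕ} (Z V : UU d) : phaseDist Z V ≤ 2 := by
  refine (ciInf_le ⟨0, ?_⟩ (1 : Circle)).trans ?_
  · rintro _ ⟨φ, rfl⟩
    exact norm_nonneg _
  · rw [opNorm, map_sub, Circle.coe_one, one_smul]
    refine ContinuousLinearMap.opNorm_le_bound _ (by norm_num) fun x => ?_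
    rw [sub_apply]
    refine (norm_sub_le _ _).trans ?_
    rw [norm_toEuclideanCLM_apply, norm_toEuclideanCLM_apply]
    linarith

/-- Of the exponent 12, ten powers of `M ≥ 2` beat 625 and two remain: one absorbs the factor 2 from
the union bound, the other gives `η`. -/
lemma two_mul_pow_mul_exp_le {d : ℕ} [NeZero d] (η : ℝ) (hη : 0 < η) :
    2 * (625 ^ d * Real.exp (-(12 * d * Real.log (max 2 (1 / η))))) ≤ η := by
  set M := max 2 (1 / η) with hM
  have hM2 : 2 ≤ M := le_max_left _ _
  have hM0 : 0 < M := by linarith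
  have hMη : M⁻¹ ≤ η := by
    rw [inv_le_comm₀ hM0 hη, ← one_div]; exact le_max_right _ _
  have hd : 1 ≤ d := Nat.one_le_iff_ne_zero.2 (NeZero.ne d)
  have e : Real.exp (-(12 * d * Real.log M)) = (M⁻¹ ^ 12) ^ d := by
    rw [← pow_mul, inv_pow, Real.exp_neg,
      show 12 * (d : ℝ) * Real.log M = ((12 * d : ℕ) : ℝ) * Real.log M by push_cast; ring,
      Real.exp_nat_mul, Real.exp_log hM0]
  have hi0 : 0 < M⁻¹ := by positivity
  have hi : M⁻¹ ≤ 1 / 2 := by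
    rw [inv_le_comm₀ hM0 (by norm_num)]; simpa using hM2
  have h10 : 625 * M⁻¹ ^ 10 ≤ 1 := by
    have : M⁻¹ ^ 10 ≤ (1 / 2) ^ 10 := by gcongr
    norm_num at this ⊢
    linarith
  have hbase : 625 * M⁻¹ ^ 12 ≤ M⁻¹ ^ 2 := by
    calc 625 * M⁻¹ ^ 12 = (625 * M⁻¹ ^ 10) * M⁻¹ ^ 2 := by ring
      _ ≤ 1 * M⁻¹ ^ 2 := by gcongr
      _ = _ := one_mul _
  have hle1 : M⁻¹ ^ 2 ≤ 1 := pow_le_one₀ hi0.le (by linarith)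
  calc 2 * (625 ^ d * Real.exp (-(12 * d * Real.log M))) = 2 * (625 * M⁻¹ ^ 12) ^ d := by
        rw [e, mul_pow]
    _ ≤ 2 * (M⁻¹ ^ 2) ^ d := by gcongr
    _ ≤ 2 * (M⁻¹ ^ 2) ^ 1 := by
      gcongr 2 * ?_
      exact pow_le_pow_of_le_one (by positivity) hle1 hd
    _ ≤ M⁻¹ := by nlinarith
    _ ≤ η := hMη

/-- The algorithm that outputs the identity without any query. -/
def trivialAlgorithm (d : ℕ) [NeZero d] : TomographyAlgorithm d where
  Seed := Unit
  seedLaw := Measure.dirac ()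
  protocol := fun _ => .output 1
  measurable_law := fun _ => measurable_const

lemma exists_algorithm (d : ℕ) [NeZero d] (ε η : ℝ) (hε : 0 < ε) (hη : 0 < η) :
    ∃ A : TomographyAlgorithm d,
      A.QueriesAtMost (825753600016 * ((d : ℝ) ^ 2 / ε ^ 2) * Real.log (max 2 (1 / η))) ∧
      ∀ Z : UU d, A.outputLaw Z {V | ¬ phaseDist Z V ≤ ε} ≤ ENNReal.ofReal η := by
  set L := Real.log (max 2 (1 / η)) with hL
  have hL2 : 1 / 2 ≤ L := by
    have h1 : Real.log 2 ≤ L := Real.log_le_log (by norm_num) (le_max_left _ _)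
    linarith [Real.log_two_gt_d9]
  have hd : (1 : ℝ) ≤ d := by exact_mod_cast Nat.one_le_iff_ne_zero.2 (NeZero.ne d)
  -- For large `ε` the budget may be below one query, while any output is within distance 2.
  rcases le_or_gt 2 ε with hε2 | hε2
  · refine ⟨trivialAlgorithm d, fun _ => ?_, fun Z => ?_⟩
    · simp only [trivialAlgorithm, Protocol.queries, Nat.cast_zero]
      positivity
    · have : {V : UU d | ¬ phaseDist Z V ≤ ε} = ∅ := by
        ext V; simpa using (phaseDist_le_two Z V).trans hε2
      rw [this, measure_empty]
      exact zero_le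
  -- The constant is `12 * 6400 * 5376000`, where `δ ^ 2 = ε ^ 2 / (6400 * d)`, so the first tail
  -- has exponent at least `12 * d * L`. Reusing it for `n` is generous.
  set m : ℕ := ⌈412876800000 * ((d : ℝ) ^ 2 * L / ε ^ 2)⌉₊ with hm
  set n : ℕ := ⌈412876800000 * (d * L / ε ^ 2)⌉₊ with hn
  have hd0 : (0 : ℝ) < d := by linarith
  have hL0 : 0 < L := by linarith
  have hm0 : m ≠ 0 := (Nat.ceil_pos.2 (by positivity)).ne'
  have hn0 : n ≠ 0 := (Nat.ceil_pos.2 (by positivity)).ne'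
  set τ : ℝ := ε / 4 with hτ
  have hsd : 1 ≤ Real.sqrt d := Real.one_le_sqrt.2 hd
  set δ : ℝ := τ / (20 * Real.sqrt d) with hδ
  have hτ0 : 0 < τ := by positivity
  have hδ0 : 0 < δ := by positivity
  have hδ1 : δ ≤ 1 := by
    rw [hδ, div_le_one (by positivity)]; linarith
  have hδτ : 20 * δ * Real.sqrt d ≤ τ := by
    apply le_of_eq; rw [hδ]; field_simp
  obtain ⟨A, hA, hlaw⟩ := exists_trials_algorithm
    (Sum.elim (fun _ : Fin m => probe (0 : Fin d)) fun j : Fin d × Fin n => probe j.1)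
    (by rintro (i | i) <;> exact norm_probe _)
    fun ω => decode δ (2 * τ) (ω ∘ Sum.inl) (ω ∘ Sum.inr)
  refine ⟨A, fun s => (hA s).trans ?_, fun Z => ?_⟩
  · simp only [Fintype.card_sum, Fintype.card_prod, Fintype.card_fin]
    push_cast
    have h1 : (m : ℝ) ≤ 412876800000 * ((d : ℝ) ^ 2 * L / ε ^ 2) + 1 :=
      (Nat.ceil_lt_add_one (by positivity)).le
    have h2 : (n : ℝ) ≤ 412876800000 * (d * L / ε ^ 2) + 1 :=
      (Nat.ceil_lt_add_one (by positivity)).le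
    have h3 : (d : ℝ) * n ≤ 412876800000 * ((d : ℝ) ^ 2 * L / ε ^ 2) + d := by
      calc (d : ℝ) * n ≤ d * (412876800000 * (d * L / ε ^ 2) + 1) := by gcongr
        _ = _ := by ring
    -- Rounding up costs at most `1 + d ≤ 2 * d` queries, which accounts for the final 16 in the
    -- constant.
    have h4 : (d : ℝ) ≤ 8 * ((d : ℝ) ^ 2 * L / ε ^ 2) := by
      rw [mul_div_assoc', le_div_iff₀ (by positivity)]
      have h5 : ε ^ 2 ≤ 4 := by nlinarith
      have h6 : (d : ℝ) ≤ d ^ 2 := by nlinarith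
      calc (d : ℝ) * ε ^ 2 ≤ (d : ℝ) ^ 2 * 4 := by gcongr
        _ = 8 * ((d : ℝ) ^ 2 * (1 / 2)) := by ring
        _ ≤ 8 * ((d : ℝ) ^ 2 * L) := by gcongr
    rw [show 825753600016 * ((d : ℝ) ^ 2 / ε ^ 2) * L =
      825753600016 * ((d : ℝ) ^ 2 * L / ε ^ 2) by ring]
    linarith
  · rw [hlaw Z {V | ¬ phaseDist Z V ≤ ε} (measurableSet_phaseDist_le Z ε).compl]
    refine ENNReal.ofReal_le_ofReal ?_
    have h := sum_decode_failure_le hm0 hn0 Z δ τ hδ0.le hδ1 hτ0.le (by linarith) hδτ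
    rw [show 4 * τ = ε by rw [hτ]; ring] at h
    refine h.trans (le_trans ?_ (two_mul_pow_mul_exp_le (d := d) η hη))
    rw [two_mul, ← hL]
    have hm1 : 412876800000 * ((d : ℝ) ^ 2 * L / ε ^ 2) ≤ m := Nat.le_ceil _
    have hn1 : 412876800000 * (d * L / ε ^ 2) ≤ n := Nat.le_ceil _
    have hexp₁ : 12 * d * L ≤ m * δ ^ 2 / 5376000 := by
      have hδ2 : δ ^ 2 = ε ^ 2 / (6400 * d) := by
        rw [hδ, div_pow, mul_pow, Real.sq_sqrt hd0.le, hτ]; field_simp; norm_num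
      calc 12 * d * L = 412876800000 * ((d : ℝ) ^ 2 * L / ε ^ 2) * δ ^ 2 / 5376000 := by
            rw [hδ2]; field_simp; norm_num
        _ ≤ _ := by gcongr
    have hexp₂ : 12 * d * L ≤ n * τ ^ 2 / 5376000 := by
      calc 12 * d * L ≤ 4800 * (d * L) := by nlinarith [mul_pos hd0 hL0]
        _ = 412876800000 * (d * L / ε ^ 2) * τ ^ 2 / 5376000 := by
            rw [hτ]; field_simp; norm_num
        _ ≤ _ := by gcongr
    gcongr

end UnitaryTomography
end

theorem theorem3 :
    ∃ C : ℝ, 0 < C ∧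
      ∃ alg : (d : ℕ) → [NeZero d] → (ε η : ℝ) → UnitaryTomography.TomographyAlgorithm d,
        ∀ (d : ℕ) [NeZero d] (ε η : ℝ), 0 < ε → 0 < η →
          (alg d ε η).QueriesAtMost
            (C * ((d : ℝ) ^ 2 / ε ^ 2) * Real.log (max 2 (1 / η))) ∧
          ∀ Z : UnitaryTomography.UU d,
            (alg d ε η).outputLaw Z {V | ¬ UnitaryTomography.phaseDist Z V ≤ ε} ≤
              ENNReal.ofReal η := by
  classical
  -- The family must be total in `ε` and `η`, so nonpositive parameters receive a dummy algorithm.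
  refine ⟨825753600016, by norm_num, fun d _ ε η =>
    if h : 0 < ε ∧ 0 < η then (UnitaryTomography.exists_algorithm d ε η h.1 h.2).choose
    else UnitaryTomography.trivialAlgorithm d, fun d _ ε η hε hη => ?_⟩
  dsimp only
  rw [dif_pos ⟨hε, hη⟩]
  exact (UnitaryTomography.exists_algorithm d ε η hε hη).choose_spec
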